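/- Let $F$ be a field of characteristic $0$, let $V,W$ be finite-dimensional $F$-vector spaces with $V\neq 0$, and let $G_1\subset GL(W)$ and $G_2\subset GL(V)$ be subgroups such that $G_2$ contains the group $F^\times$ of scalar automorphisms. Let $M\subset \mathrm{Hom}_F(V,W)$ be an $F$-subspace with $G_1M=M=MG_2$, let $$G=\begin{pmatrix}G_1&M\\0&G_2\end{pmatrix}\subset GL(W\oplus V),$$ and suppose that $\det:G\to F^\times$ is surjective. For a subgroup $K\subset GL(W\oplus V)$ write $SK=K\cap SL(W\oplus V)$. If $\det: K\to F^\times$ is surjective, then conjugation in $K$ makes every $H_i(SK,\mathbb Z)$ a module over the group ring $\mathbb Z[F^\times]$, via the exact sequence $1\to SK\to K\xrightarrow{\det}F^\times\to 1$; this applies to $K=G$ and to $K=G_1\times G_2$, embedded block-diagonally. Write $\langle a\rangle\in\mathbb Z[F^\times]$ for the basis element of $a\in F^\times$, and let $\mathcal M_{\mathbb Q}\subset\mathbb Z[F^\times]$ be the multiplicative set generated by the elements $\langle a\rangle-1$ with $a\in\mathbb Q^\times\setminus\{1,-1\}$. Call a $\mathbb Z[F^\times]$-module *multiplicative* if it is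 annihilated by some $s\in\mathcal M_{\mathbb Q}$, *additive* if every $s\in\mathcal M_{\mathbb Q}$ acts on it as an automorphism, and an *$\mathcal{AM}$-module* if it is isomorphic to the direct sum of an additive and a multiplicative module. For a $\mathbb Z[F^\times]$-module $H$ let $H_{\mathcal A}$ (respectively $H_{\mathcal M}$) be the sum of all its additive (respectively multiplicative) submodules. Then for every $i\geq 1$ the module $H=H_i(SG,\mathbb Z)$ is an $\mathcal{AM}$-module; $H_{\mathcal A}$ is additive, $H_{\mathcal M}$ is multiplicative, and $H=H_{\mathcal A}\oplus H_{\mathcal M}$. Moreover, the inclusion $j:S(G_1\times G_2)\to SG$ induces an isomorphism of $\mathbb Z[F^\times]$-modules from $H_i(S(G_1\times G_2),\mathbb Z)$ onto $H_i(SG,\mathbb Z)_{\mathcal M}$. -/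

import Mathlib

open CategoryTheory

universe u

namespace SpecialHomology

noncomputable section

/-! ### Integral group homology and its conjugation action -/

section Conjugation

variable {k G : Type u} [CommRing k] [Group G]

/-- The action of `g` on `A`, as a morphism from `A` to its restriction along conjugation by `g`. -/
def conjHom (A : Rep.{u} k G) (g : G) : A ⟶ Rep.res (MulAut.conj g).toMonoidHom A :=
  Rep.ofHom ⟨A.ρ g, fun h => by
    ext x
    simp [← Module.End.mul_apply, ← map_mul]⟩

theorem isZero_ind (A : Rep.{u} k G) (n : ℕ) :
    Limits.IsZero (groupHomology (Rep.ind (⊥ : Subgroup G).subtype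
      (Rep.res (⊥ : Subgroup G).subtype A)) (n + 1)) := by
  classical
  exact (isZero_groupHomology_succ_of_subsingleton _ n).of_iso (groupHomology.indIso _ _ _)

/-- Inner automorphisms act trivially on group homology. -/
theorem map_conj (g : G) (n : ℕ) : ∀ A : Rep.{u} k G,
    groupHomology.map (MulAut.conj g).toMonoidHom (conjHom A g) n = 𝟙 _ := by
  induction n with
  | zero =>
    intro A
    rw [← cancel_epi (groupHomology.H0π A), groupHomology.H0π_comp_map,
      ← cancel_mono (groupHomology.H0Iso A).hom]
    simp only [Category.assoc, Category.comp_id, groupHomology.H0π_comp_H0Iso_hom]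
    ext x
    exact Representation.Coinvariants.mk_self_apply A.ρ g x
  | succ n ih =>
    intro A
    let ad := Rep.indResAdjunction.{u} k (⊥ : Subgroup G).subtype
    let p := ad.counit.app A
    have : Epi p := inferInstance
    let X : ShortComplex (Rep.{u} k G) := ShortComplex.mk (Limits.kernel.ι p) p (by simp)
    have hX : X.ShortExact :=
      { exact := ShortComplex.exact_kernel p
        mono_f := by dsimp [X]; infer_instance
        epi_g := by dsimp [X]; infer_instance }
    have hC := groupHomology.map_chainsFunctor_shortExact hX
    let c := (MulAut.conj g).toMonoidHom
    have key : ∀ {A B : Rep.{u} k G} (f : A ⟶ B),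
        groupHomology.chainsMap c (conjHom A g) ≫ groupHomology.chainsMap (MonoidHom.id G) f =
        groupHomology.chainsMap (MonoidHom.id G) f ≫ groupHomology.chainsMap c (conjHom B g) := by
      intro A B f
      rw [← groupHomology.chainsMap_comp, ← groupHomology.chainsMap_comp]
      refine groupHomology.chainsMap_congr rfl ?_
      ext x
      exact Rep.hom_comm_apply f g x
    let φ : X.map (groupHomology.chainsFunctor k G) ⟶ X.map (groupHomology.chainsFunctor k G) :=
      { τ₁ := groupHomology.chainsMap c (conjHom _ g)
        τ₂ := groupHomology.chainsMap c (conjHom _ g)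
        τ₃ := groupHomology.chainsMap c (conjHom _ g)
        comm₁₂ := key _
        comm₂₃ := key _ }
    have hm : Mono (groupHomology.δ hX (n + 1) n rfl) :=
      groupHomology.mono_δ_of_isZero hX n (isZero_ind A n)
    have hn := HomologicalComplex.HomologySequence.δ_naturality φ hC hC (n + 1) n rfl
    have h2 := ih X.X₁
    rw [← cancel_mono (groupHomology.δ hX (n + 1) n rfl)]
    refine (hn.symm.trans ?_).trans (Category.id_comp _).symm
    exact (congrArg (fun t => groupHomology.δ hX (n + 1) n rfl ≫ t) h2).trans (Category.comp_id _)

end Conjugation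

section IntegralHomology

/-- The integers with trivial action of `G`; the lift to the universe of `G` is the one in which
Mathlib's group homology is available. -/
abbrev trivialZ (G : Type u) [Group G] : Rep.{u} (ULift.{u} ℤ) G :=
  Rep.trivial (ULift.{u} ℤ) G (ULift.{u} ℤ)

/-- The integral homology group `H_n(G, ℤ)`. -/
abbrev Homology (n : ℕ) (G : Type u) [Group G] : Type u :=
  groupHomology (trivialZ G) n

variable {G H K : Type u} [Group G] [Group H] [Group K]

/-- The homomorphism `H_n(G, ℤ) → H_n(H, ℤ)` induced by a group homomorphism. -/
def homologyMap (n : ℕ) (f : G →* H) : Homology n G →+ Homology n H :=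
  (groupHomology.map (A := trivialZ G) (B := trivialZ H) f
    (Rep.ofHom ⟨LinearMap.id, fun _ => rfl⟩) n).hom.toAddMonoidHom

theorem homologyMap_id (n : ℕ) : homologyMap n (MonoidHom.id G) = AddMonoidHom.id _ := by
  ext x
  exact congrArg (fun t => t.hom x) (groupHomology.map_id (A := trivialZ G) n)

theorem homologyMap_comp (n : ℕ) (f : H →* K) (g : G →* H) :
    homologyMap n (f.comp g) = (homologyMap n f).comp (homologyMap n g) := by
  ext x
  exact congrArg (fun t => t.hom x)
    (groupHomology.map_comp (A := trivialZ G) (B := trivialZ H) (C := trivialZ K) g f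
      (Rep.ofHom ⟨LinearMap.id, fun _ => rfl⟩) (Rep.ofHom ⟨LinearMap.id, fun _ => rfl⟩) n)

theorem homologyMap_conj (n : ℕ) (g : G) :
    homologyMap n (MulAut.conj g).toMonoidHom = AddMonoidHom.id _ := by
  ext x
  exact congrArg (fun t => t.hom x) (map_conj g n (trivialZ G))

variable {D : Type u} [Group D] (n : ℕ) (φ : G →* D)

/-- `G` acts on `H_n(ker φ, ℤ)` through its conjugation action on `ker φ`. -/
def conjAction : Representation ℤ G (Homology n φ.ker) where
  toFun g := (homologyMap n (MulAut.conjNormal (H := φ.ker) g).toMonoidHom).toIntLinearMap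
  map_one' := by
    have : (MulAut.conjNormal (H := φ.ker) (1 : G)).toMonoidHom = MonoidHom.id _ := by
      rw [map_one]; rfl
    rw [this, homologyMap_id]
    rfl
  map_mul' g h := by
    have : (MulAut.conjNormal (H := φ.ker) (g * h)).toMonoidHom =
        (MulAut.conjNormal (H := φ.ker) g).toMonoidHom.comp
          (MulAut.conjNormal (H := φ.ker) h).toMonoidHom := by
      rw [map_mul]; rfl
    rw [this, homologyMap_comp]
    rfl

theorem ker_le_ker_conjAction (g : G) (hg : g ∈ φ.ker) : conjAction n φ g = 1 := by
  have : MulAut.conjNormal (H := φ.ker) g = MulAut.conj (⟨g, hg⟩ : φ.ker) := by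
    ext; simp
  change (homologyMap n (MulAut.conjNormal (H := φ.ker) g).toMonoidHom).toIntLinearMap = 1
  rw [this, homologyMap_conj]
  rfl

variable {φ} in
/-- If `1 → ker φ → G → D → 1` is exact, then `D` acts on `H_n(ker φ, ℤ)`: the action of `d` is
induced by conjugation by any preimage of `d` in `G`. -/
def quotientAction (hφ : Function.Surjective φ) : Representation ℤ D (Homology n φ.ker) :=
  (QuotientGroup.lift φ.ker (conjAction n φ) (ker_le_ker_conjAction n φ)).comp
    (QuotientGroup.quotientKerEquivOfSurjective φ hφ).symm.toMonoidHom

theorem quotientAction_apply (hφ : Function.Surjective φ) (g : G) :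
    quotientAction n hφ (φ g) = conjAction n φ g := by
  have : (QuotientGroup.quotientKerEquivOfSurjective φ hφ).symm (φ g) = (g : G ⧸ φ.ker) := by
    rw [MulEquiv.symm_apply_eq]; rfl
  change QuotientGroup.lift φ.ker (conjAction n φ) (ker_le_ker_conjAction n φ)
    ((QuotientGroup.quotientKerEquivOfSurjective φ hφ).symm (φ g)) = _
  rw [this]
  rfl

end IntegralHomology

/-! ### Additive, multiplicative and `AM` modules -/

section Modules

variable (F : Type u) [Field F] [CharZero F]

/-- The multiplicative subset of `ℤ[Fˣ]` generated by the elements `⟨a⟩ - 1` with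
`a ∈ ℚˣ`, `a ≠ ±1`. -/
def rationalSet : Submonoid (MonoidAlgebra ℤ Fˣ) :=
  Submonoid.closure {s | ∃ a : ℚˣ, a ≠ 1 ∧ a ≠ -1 ∧
    s = MonoidAlgebra.of ℤ Fˣ (Units.map (Rat.castHom F).toMonoidHom a) - 1}

variable (H : Type u) [AddCommGroup H] [Module (MonoidAlgebra ℤ Fˣ) H]

/-- Some element of the rational multiplicative set annihilates `H`. -/
def IsMultiplicative : Prop := ∃ s ∈ rationalSet F, ∀ x : H, s • x = 0

/-- Every element of the rational multiplicative set acts as an automorphism of `H`. -/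
def IsAdditive : Prop := ∀ s ∈ rationalSet F, Function.Bijective fun x : H => s • x

/-- `H` is isomorphic to the direct sum of an additive and a multiplicative module. -/
def IsAM : Prop :=
  ∃ (A M : Type u) (_ : AddCommGroup A) (_ : AddCommGroup M)
    (_ : Module (MonoidAlgebra ℤ Fˣ) A) (_ : Module (MonoidAlgebra ℤ Fˣ) M),
    IsAdditive F A ∧ IsMultiplicative F M ∧ Nonempty (H ≃ₗ[MonoidAlgebra ℤ Fˣ] A × M)

/-- The additive part: the sum of all additive submodules. -/
def additivePart : Submodule (MonoidAlgebra ℤ Fˣ) H :=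
  sSup {N | IsAdditive F N}

/-- The multiplicative part: the sum of all multiplicative submodules. -/
def multiplicativePart : Submodule (MonoidAlgebra ℤ Fˣ) H :=
  sSup {N | IsMultiplicative F N}

end Modules

/-! ### Block-triangular groups -/

section Groups

variable {F : Type u} [Field F]

section Special

variable {E : Type u} [AddCommGroup E] [Module F E]

/-- The determinant `G → Fˣ` on a subgroup `G` of `GL(E)`. -/
def detOn (G : Subgroup (LinearMap.GeneralLinearGroup F E)) : G →* Fˣ :=
  (Units.map (LinearMap.det : (E →ₗ[F] E) →* F)).comp G.subtype

/-- `SG = G ∩ SL(E)`, as a subgroup of `G`. -/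
abbrev special (G : Subgroup (LinearMap.GeneralLinearGroup F E)) : Subgroup G := (detOn G).ker

/-- `H_n(SG, ℤ)` as a `ℤ[Fˣ]`-module, through the exact sequence `1 → SG → G → Fˣ → 1`. -/
abbrev SHomology (n : ℕ) {G : Subgroup (LinearMap.GeneralLinearGroup F E)} (hG : Function.Surjective (detOn G)) : Type u :=
  (quotientAction n hG).asModule

/-- The inclusion `SG → SG'` for subgroups `G ≤ G'` of `GL(E)`. -/
def specialInclusion {G G' : Subgroup (LinearMap.GeneralLinearGroup F E)} (h : G ≤ G') : special G →* special G' :=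
  ((Subgroup.inclusion h).comp (special G).subtype).codRestrict (special G') fun x => x.2

end Special

variable {W V : Type u} [AddCommGroup W] [Module F W] [AddCommGroup V] [Module F V]

/-- The endomorphism of `W ⊕ V` with block matrix `((a, f), (0, b))`. -/
def blockMap (a : W →ₗ[F] W) (f : V →ₗ[F] W) (b : V →ₗ[F] V) : (W × V) →ₗ[F] (W × V) :=
  (a.coprod f).prod (b ∘ₗ LinearMap.snd F W V)

@[simp]
theorem blockMap_apply (a : W →ₗ[F] W) (f : V →ₗ[F] W) (b : V →ₗ[F] V) (x : W × V) :
    blockMap a f b x = (a x.1 + f x.2, b x.2) := rfl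

theorem blockMap_mul (a a' : W →ₗ[F] W) (f f' : V →ₗ[F] W) (b b' : V →ₗ[F] V) :
    blockMap a f b * blockMap a' f' b' = blockMap (a * a') (a ∘ₗ f' + f ∘ₗ b') (b * b') := by
  refine LinearMap.ext fun x => ?_
  simp [add_assoc]

theorem blockMap_one : blockMap (1 : W →ₗ[F] W) (0 : V →ₗ[F] W) (1 : V →ₗ[F] V) = 1 := by
  refine LinearMap.ext fun x => ?_
  simp

theorem det_blockMap [FiniteDimensional F W] [FiniteDimensional F V]
    (a : W →ₗ[F] W) (f : V →ₗ[F] W) (b : V →ₗ[F] V) :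
    LinearMap.det (blockMap a f b) = LinearMap.det a * LinearMap.det b := by
  let c := Module.Free.chooseBasis F W
  let c' := Module.Free.chooseBasis F V
  have : LinearMap.toMatrix (c.prod c') (c.prod c') (blockMap a f b) =
      Matrix.fromBlocks (LinearMap.toMatrix c c a) (LinearMap.toMatrix c' c f) 0
        (LinearMap.toMatrix c' c' b) := by
    ext (i | i) (j | j) <;> simp [LinearMap.toMatrix_apply]
  rw [← LinearMap.det_toMatrix (c.prod c'), this, Matrix.det_fromBlocks_zero₂₁,
    LinearMap.det_toMatrix, LinearMap.det_toMatrix]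

/-- The group of all `((g₁, f), (0, g₂))` with `g₁ ∈ G₁`, `f ∈ M`, `g₂ ∈ G₂`. As `G₁` and `G₂` are
groups, `h₁` and `h₂` say that `G₁ M = M = M G₂`. -/
def blockTriangular (G₁ : Subgroup (LinearMap.GeneralLinearGroup F W)) (G₂ : Subgroup (LinearMap.GeneralLinearGroup F V))
    (M : Submodule F (V →ₗ[F] W))
    (h₁ : ∀ g ∈ G₁, ∀ f ∈ M, g.val ∘ₗ f ∈ M) (h₂ : ∀ g ∈ G₂, ∀ f ∈ M, f ∘ₗ g.val ∈ M) :
    Subgroup (LinearMap.GeneralLinearGroup F (W × V)) where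
  carrier := {g | ∃ g₁ ∈ G₁, ∃ f ∈ M, ∃ g₂ ∈ G₂, g.val = blockMap g₁.val f g₂.val}
  one_mem' := ⟨1, one_mem _, 0, zero_mem _, 1, one_mem _, blockMap_one.symm⟩
  mul_mem' := by
    rintro g g' ⟨a, ha, f, hf, b, hb, h⟩ ⟨a', ha', f', hf', b', hb', h'⟩
    refine ⟨a * a', mul_mem ha ha', a.val ∘ₗ f' + f ∘ₗ b'.val,
      add_mem (h₁ a ha f' hf') (h₂ b' hb' f hf), b * b', mul_mem hb hb', ?_⟩
    rw [Units.val_mul, h, h', blockMap_mul, Units.val_mul, Units.val_mul]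
  inv_mem' := by
    rintro g ⟨a, ha, f, hf, b, hb, h⟩
    refine ⟨a⁻¹, inv_mem ha, -(a⁻¹.val ∘ₗ f ∘ₗ b⁻¹.val),
      neg_mem (h₁ _ (inv_mem ha) _ (h₂ _ (inv_mem hb) f hf)), b⁻¹, inv_mem hb, ?_⟩
    refine Units.inv_eq_of_mul_eq_one_right ?_
    rw [h, blockMap_mul, ← Units.val_mul, ← Units.val_mul, mul_inv_cancel, mul_inv_cancel]
    have : a.val ∘ₗ (-(a⁻¹.val ∘ₗ f ∘ₗ b⁻¹.val)) + f ∘ₗ b⁻¹.val = 0 := by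
      rw [LinearMap.comp_neg, ← LinearMap.comp_assoc, ← Module.End.mul_eq_comp, ← Units.val_mul,
        mul_inv_cancel]
      exact neg_add_cancel _
    rw [this]
    exact blockMap_one

/-- The block-diagonal embedding `GL(W) × GL(V) → GL(W ⊕ V)`. -/
def blockDiagonalHom :
    LinearMap.GeneralLinearGroup F W × LinearMap.GeneralLinearGroup F V →*
      LinearMap.GeneralLinearGroup F (W × V) :=
  (Units.map (LinearMap.prodMapRingHom F W V).toMonoidHom).comp MulEquiv.prodUnits.symm.toMonoidHom

/-- `G₁ × G₂`, embedded in `GL(W ⊕ V)` as a group of block-diagonal automorphisms. -/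
def blockDiagonal (G₁ : Subgroup (LinearMap.GeneralLinearGroup F W))
    (G₂ : Subgroup (LinearMap.GeneralLinearGroup F V)) :
    Subgroup (LinearMap.GeneralLinearGroup F (W × V)) :=
  (G₁.prod G₂).map blockDiagonalHom

theorem val_blockDiagonalHom (a : LinearMap.GeneralLinearGroup F W)
    (b : LinearMap.GeneralLinearGroup F V) :
    (blockDiagonalHom (a, b)).val = blockMap a.val 0 b.val := by
  refine LinearMap.ext fun x => ?_
  rw [blockMap_apply, LinearMap.zero_apply, add_zero]
  rfl

variable {G₁ : Subgroup (LinearMap.GeneralLinearGroup F W)} {G₂ : Subgroup (LinearMap.GeneralLinearGroup F V)} {M : Submodule F (V →ₗ[F] W)}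
  (h₁ : ∀ g ∈ G₁, ∀ f ∈ M, g.val ∘ₗ f ∈ M) (h₂ : ∀ g ∈ G₂, ∀ f ∈ M, f ∘ₗ g.val ∈ M)

theorem blockDiagonal_le : blockDiagonal G₁ G₂ ≤ blockTriangular G₁ G₂ M h₁ h₂ := by
  rintro _ ⟨⟨a, b⟩, ⟨ha, hb⟩, rfl⟩
  exact ⟨a, ha, 0, zero_mem _, b, hb, val_blockDiagonalHom a b⟩

variable [FiniteDimensional F W] [FiniteDimensional F V]

variable {h₁ h₂} in
/-- The determinant takes the same values on `G₁ × G₂` as on the block-triangular group. -/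
theorem detOn_blockDiagonal_surjective
    (h : Function.Surjective (detOn (blockTriangular G₁ G₂ M h₁ h₂))) :
    Function.Surjective (detOn (blockDiagonal G₁ G₂)) := by
  intro d
  obtain ⟨⟨g, a, ha, f, hf, b, hb, hg⟩, rfl⟩ := h d
  refine ⟨⟨blockDiagonalHom (a, b), (a, b), ⟨ha, hb⟩, rfl⟩, ?_⟩
  ext
  simp only [detOn, MonoidHom.comp_apply, Units.coe_map, Subgroup.subtype_apply, hg,
    val_blockDiagonalHom, det_blockMap]

end Groups

end

end SpecialHomology

open SpecialHomology

/-!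
The projection of block-triangular matrices to their diagonal blocks makes `SG` an extension of
`S(G₁ × G₂)` by the group of unipotent matrices `((1, f), (0, 1))`, which is a torsion-free abelian
group, and the inclusion `j : S(G₁ × G₂) → SG` is a section of this extension. So `H_i(SG, ℤ)` is
the direct sum of the kernel of the projection and the image of `j` (`isCompl_ker_range`), and `j`
is injective on homology. It suffices that the kernel is additive and the image multiplicative:
these then are the additive and the multiplicative part (`additivePart_eq`,
`multiplicativePart_eq`).

The scalar `a` on `V` has determinant `a ^ d` with `d = dim V`, so that `⟨a ^ d⟩` acts on homology
by conjugation with this scalar (`of_smul_eq`). The scalar is central in `G₁ × G₂`, hence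
`⟨2 ^ d⟩ - 1` annihilates the image of `j` (`isMultiplicative_range_incl`).

On the unipotent group, conjugation by the scalar `m⁻¹` is the `m`-th power map. On the homology
`H_n` of a torsion-free abelian group with trivial coefficients, the `m`-th power map has the
single generalized eigenvalue `m ^ n` (`hasPowWeight_of_torsionFree`). Homology being the union of
the homology of the finitely generated subgroups, it is enough to consider free abelian groups of
finite rank, and there one inducts on the rank, through the long exact homology sequence of
`0 → k[ℤ] ⊗ A → k[ℤ] ⊗ A → A → 0` and Shapiro's lemma (`HasPowWeight.of_cyclic_quotient`).

Now let `E → Q` be a split extension whose kernel `N` has such power maps, extended to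
automorphisms `φ m` of `E` over `Q`. On the kernel of `H_n(E, A) → H_n(Q, A)`, for coefficients `A`
inflated from `Q`, the operator `φ p - φ q` is bijective for all `p ≠ q` (`twist_sub_bijective`).
In degree zero the kernel vanishes. For free `A = k[Q] ⊗ B` and `n ≥ 1`, the group `H_n(E, A)` is a
quotient of `H_n(N, B)` by Shapiro's lemma, and `φ p - φ q` is bijective since it differs from
`p ^ n - q ^ n` by commuting locally nilpotent operators (`bijective_sub_of_maxGenEigenspace`). The
general case follows by dimension shifting in `A`. Finally, `⟨a⟩ - 1` divides `⟨a ^ (2 * d)⟩ - 1`,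
and the square of a rational number `a ≠ ±1` is a quotient of two different positive integers, so
that each generator `⟨a⟩ - 1` acts bijectively on the kernel of the projection
(`isAdditive_ker_proj`).
-/

namespace SpecialHomology

noncomputable section

/-! ### Functoriality and long exact sequences of group homology -/

section Layer

variable {k G H K : Type u} [CommRing k] [Group G] [Group H] [Group K]

/-- `u` is equivariant along the group homomorphism `f`. -/
def IsEquivariant (A : Rep.{u} k G) (B : Rep.{u} k H) (f : G →* H) (u : A.V →ₗ[k] B.V) : Prop :=
  ∀ g x, u (A.ρ g x) = B.ρ (f g) (u x)

variable {A A' : Rep.{u} k G} {B B' : Rep.{u} k H} {C C' : Rep.{u} k K}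

/-- The morphism of representations given by an equivariant map. -/
def IsEquivariant.toHom {f : G →* H} {u : A.V →ₗ[k] B.V} (h : IsEquivariant A B f u) :
    A ⟶ Rep.res f B :=
  Rep.ofHom ⟨u, fun g => LinearMap.ext fun x => h g x⟩

theorem IsEquivariant.comp {f : G →* H} {g : H →* K} {u : A.V →ₗ[k] B.V} {v : B.V →ₗ[k] C.V}
    (hv : IsEquivariant B C g v) (hu : IsEquivariant A B f u) :
    IsEquivariant A C (g.comp f) (v ∘ₗ u) := fun x y => by
  simp only [LinearMap.comp_apply, hu x y, hv (f x) (u y)]; rfl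

theorem IsEquivariant.id (A : Rep.{u} k G) : IsEquivariant A A (MonoidHom.id G) LinearMap.id :=
  fun _ _ => rfl

/-- The map on homology induced by a group homomorphism and an equivariant map. -/
def hmap {f : G →* H} {u : A.V →ₗ[k] B.V} (h : IsEquivariant A B f u) (n : ℕ) :
    groupHomology A n →ₗ[k] groupHomology B n :=
  (groupHomology.map f h.toHom n).hom

theorem hmap_comp {f : G →* H} {g : H →* K} {u : A.V →ₗ[k] B.V} {v : B.V →ₗ[k] C.V}
    (hv : IsEquivariant B C g v) (hu : IsEquivariant A B f u) (n : ℕ)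
    (x : groupHomology A n) :
    hmap (hv.comp hu) n x = hmap hv n (hmap hu n x) :=
  congrArg (fun t => t.hom x) (groupHomology.map_comp f g hu.toHom hv.toHom n)

theorem hmap_id (A : Rep.{u} k G) (n : ℕ) (x : groupHomology A n) :
    hmap (IsEquivariant.id A) n x = x :=
  congrArg (fun t => t.hom x) (groupHomology.map_id (A := A) n)

theorem hmap_congr {f f' : G →* H} {u u' : A.V →ₗ[k] B.V} (h : IsEquivariant A B f u)
    (h' : IsEquivariant A B f' u') (hf : f = f') (hu : u = u') (n : ℕ) :
    hmap h n = hmap h' n := by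
  subst hf hu; rfl

/-- Two composites of equivariant maps that agree induce the same map on homology. -/
theorem hmap_hmap_eq {H' : Type u} [Group H'] {D : Rep.{u} k H'}
    {f : G →* H} {g : H →* K} {f' : G →* H'} {g' : H' →* K}
    {u : A.V →ₗ[k] B.V} {v : B.V →ₗ[k] C.V} {u' : A.V →ₗ[k] D.V} {v' : D.V →ₗ[k] C.V}
    (hv : IsEquivariant B C g v) (hu : IsEquivariant A B f u)
    (hv' : IsEquivariant D C g' v') (hu' : IsEquivariant A D f' u')
    (hf : g.comp f = g'.comp f') (h : v ∘ₗ u = v' ∘ₗ u') (n : ℕ) (x : groupHomology A n) :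
    hmap hv n (hmap hu n x) = hmap hv' n (hmap hu' n x) := by
  rw [← hmap_comp, ← hmap_comp, hmap_congr (hv.comp hu) (hv'.comp hu') hf h]

theorem hmap_hmap_eq_hmap {f : G →* H} {g : H →* K} {f' : G →* K}
    {u : A.V →ₗ[k] B.V} {v : B.V →ₗ[k] C.V} {u' : A.V →ₗ[k] C.V}
    (hv : IsEquivariant B C g v) (hu : IsEquivariant A B f u)
    (hu' : IsEquivariant A C f' u')
    (hf : g.comp f = f') (h : v ∘ₗ u = u') (n : ℕ) (x : groupHomology A n) :
    hmap hv n (hmap hu n x) = hmap hu' n x := by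
  rw [← hmap_comp, hmap_congr (hv.comp hu) hu' hf h]

theorem hmap_hmap_eq_self {f : G →* H} {g : H →* G}
    {u : A.V →ₗ[k] B.V} {v : B.V →ₗ[k] A.V}
    (hv : IsEquivariant B A g v) (hu : IsEquivariant A B f u)
    (hf : g.comp f = MonoidHom.id G) (h : v ∘ₗ u = LinearMap.id) (n : ℕ)
    (x : groupHomology A n) :
    hmap hv n (hmap hu n x) = x := by
  rw [← hmap_comp, hmap_congr (hv.comp hu) (IsEquivariant.id A) hf h, hmap_id]

theorem IsEquivariant.add {f : G →* H} {u v : A.V →ₗ[k] B.V} (hu : IsEquivariant A B f u)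
    (hv : IsEquivariant A B f v) : IsEquivariant A B f (u + v) := fun g x => by
  simp [hu g x, hv g x]

theorem hmap_add {f : G →* H} {u v : A.V →ₗ[k] B.V} (hu : IsEquivariant A B f u)
    (hv : IsEquivariant A B f v) (n : ℕ) (x : groupHomology A n) :
    hmap (hu.add hv) n x = hmap hu n x + hmap hv n x := by
  have : groupHomology.chainsMap f (hu.add hv).toHom =
      groupHomology.chainsMap f hu.toHom + groupHomology.chainsMap f hv.toHom := by
    ext i g x
    simp [groupHomology.chainsMap_f, IsEquivariant.toHom]
  have h2 : groupHomology.map f (hu.add hv).toHom n =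
      groupHomology.map f hu.toHom n + groupHomology.map f hv.toHom n := by
    unfold groupHomology.map
    rw [this, HomologicalComplex.homologyMap_add]
    rfl
  exact congrArg (fun t => t.hom x) h2

/-- The action of an element `g` on `A`, covering conjugation by `g`. -/
theorem isEquivariant_conj (A : Rep.{u} k G) (g : G) :
    IsEquivariant A A (MulAut.conj g).toMonoidHom (A.ρ g) := fun h x => by
  simp [← Module.End.mul_apply, ← map_mul]

theorem hmap_conj (A : Rep.{u} k G) (g : G) (n : ℕ) (x : groupHomology A n) :
    hmap (isEquivariant_conj A g) n x = x :=
  congrArg (fun t => t.hom x) (map_conj g n A)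

/-- A short exact sequence of representations. -/
structure ShortSeq (A B C : Rep.{u} k G) where
  /-- The injection. -/
  inc : A.V →ₗ[k] B.V
  /-- The surjection. -/
  proj : B.V →ₗ[k] C.V
  inc_equi : IsEquivariant A B (MonoidHom.id G) inc
  proj_equi : IsEquivariant B C (MonoidHom.id G) proj
  inc_injective : Function.Injective inc
  proj_surjective : Function.Surjective proj
  exact : Function.Exact inc proj

namespace ShortSeq

variable {A B C : Rep.{u} k G} (S : ShortSeq A B C)

/-- The underlying short complex. -/
def toShortComplex : ShortComplex (Rep.{u} k G) :=
  ShortComplex.mk (X₁ := A) (X₂ := B) (X₃ := C) S.inc_equi.toHom S.proj_equi.toHom (by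
    ext x
    exact S.exact.apply_apply_eq_zero x)

theorem shortExact : S.toShortComplex.ShortExact where
  exact := by
    rw [← ShortComplex.exact_map_iff_of_faithful _ (forget₂ (Rep.{u} k G) (ModuleCat.{u} k)),
      ShortComplex.ShortExact.moduleCat_exact_iff_function_exact]
    exact S.exact
  mono_f := (Rep.mono_iff_injective _).2 S.inc_injective
  epi_g := (Rep.epi_iff_surjective _).2 S.proj_surjective

/-- The connecting homomorphism. -/
def δ (n : ℕ) : groupHomology C (n + 1) →ₗ[k] groupHomology A n :=
  (groupHomology.δ S.shortExact (n + 1) n rfl).hom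

theorem exact_inc_proj (n : ℕ) :
    Function.Exact (hmap S.inc_equi n) (hmap S.proj_equi n) :=
  (ShortComplex.ShortExact.moduleCat_exact_iff_function_exact _).1
    (groupHomology.mapShortComplex₂_exact S.shortExact n)

theorem exact_proj_δ (n : ℕ) : Function.Exact (hmap S.proj_equi (n + 1)) (S.δ n) :=
  (ShortComplex.ShortExact.moduleCat_exact_iff_function_exact _).1
    (groupHomology.mapShortComplex₃_exact S.shortExact (i := n + 1) (j := n) rfl)

theorem exact_δ_inc (n : ℕ) : Function.Exact (S.δ n) (hmap S.inc_equi n) :=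
  (ShortComplex.ShortExact.moduleCat_exact_iff_function_exact _).1
    (groupHomology.mapShortComplex₁_exact S.shortExact (i := n + 1) (j := n) rfl)

theorem δ_naturality {A' B' C' : Rep.{u} k H} (S' : ShortSeq A' B' C') {f : G →* H}
    {a : A.V →ₗ[k] A'.V} {b : B.V →ₗ[k] B'.V} {c : C.V →ₗ[k] C'.V}
    (ha : IsEquivariant A A' f a) (hb : IsEquivariant B B' f b) (hc : IsEquivariant C C' f c)
    (hab : b ∘ₗ S.inc = S'.inc ∘ₗ a) (hbc : c ∘ₗ S.proj = S'.proj ∘ₗ b) (n : ℕ)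
    (x : groupHomology C (n + 1)) :
    hmap ha n (S.δ n x) = S'.δ n (hmap hc (n + 1) x) := by
  let φ : S.toShortComplex.map (groupHomology.chainsFunctor k G) ⟶
      S'.toShortComplex.map (groupHomology.chainsFunctor k H) :=
    { τ₁ := groupHomology.chainsMap f ha.toHom
      τ₂ := groupHomology.chainsMap f hb.toHom
      τ₃ := groupHomology.chainsMap f hc.toHom
      comm₁₂ := by
        refine (groupHomology.chainsMap_comp f (MonoidHom.id H) ha.toHom
          (S'.inc_equi.toHom)).symm.trans (Eq.trans ?_
          (groupHomology.chainsMap_comp (MonoidHom.id G) f S.inc_equi.toHom hb.toHom))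
        exact groupHomology.chainsMap_congr rfl hab.symm
      comm₂₃ := by
        refine (groupHomology.chainsMap_comp f (MonoidHom.id H) hb.toHom
          (S'.proj_equi.toHom)).symm.trans (Eq.trans ?_
          (groupHomology.chainsMap_comp (MonoidHom.id G) f S.proj_equi.toHom hc.toHom))
        exact groupHomology.chainsMap_congr rfl hbc.symm }
  have hn := HomologicalComplex.HomologySequence.δ_naturality φ
    (groupHomology.map_chainsFunctor_shortExact S.shortExact)
    (groupHomology.map_chainsFunctor_shortExact S'.shortExact) (n + 1) n rfl
  exact congrArg (fun t => t.hom x) hn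

/-- Restriction of a short exact sequence along a group homomorphism. -/
def res (f : H →* G) : ShortSeq (Rep.res f A) (Rep.res f B) (Rep.res f C) where
  inc := S.inc
  proj := S.proj
  inc_equi g x := S.inc_equi (f g) x
  proj_equi g x := S.proj_equi (f g) x
  inc_injective := S.inc_injective
  proj_surjective := S.proj_surjective
  exact := S.exact

end ShortSeq

/-- The class in `H₀` of an element of the representation. -/
def zeroClass (A : Rep.{u} k G) : A.V →ₗ[k] groupHomology A 0 := (groupHomology.H0π A).hom

theorem zeroClass_surjective (A : Rep.{u} k G) : Function.Surjective (zeroClass A) :=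
  (ModuleCat.epi_iff_surjective (groupHomology.H0π A)).1 inferInstance

theorem hmap_zeroClass {f : G →* H} {u : A.V →ₗ[k] B.V} (h : IsEquivariant A B f u) (x : A.V) :
    hmap h 0 (zeroClass A x) = zeroClass B (u x) :=
  congrArg (fun t => t.hom x) (groupHomology.H0π_comp_map f h.toHom)

theorem zeroClass_eq_zero_iff (x : A.V) :
    zeroClass A x = 0 ↔ Representation.Coinvariants.mk A.ρ x = 0 := by
  have h : (groupHomology.H0Iso A).hom.hom (zeroClass A x) = Representation.Coinvariants.mk A.ρ x :=
    congrArg (fun t => t.hom x) (groupHomology.H0π_comp_H0Iso_hom A)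
  rw [← h]
  constructor
  · intro h; rw [h, map_zero]
  · intro h
    exact (groupHomology.H0Iso A).toLinearEquiv.injective (h.trans (map_zero _).symm)

theorem zeroClass_smul (g : G) (x : A.V) : zeroClass A (A.ρ g x) = zeroClass A x := by
  rw [← sub_eq_zero, ← map_sub, zeroClass_eq_zero_iff, map_sub, sub_eq_zero]
  exact Representation.Coinvariants.mk_self_apply A.ρ g x

end Layer

/-! ### Induced, free and permutation representations -/

section Acyclic

variable {k G : Type u} [CommRing k] [Group G]

/-- If an equivariant map `c : X → k[G] ⊗ Y` is split by the equivariant extension of a linear map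
`p : Y → X`, then `X` has no homology in positive degrees: it is a retract of the representation
induced from its restriction to the trivial subgroup. -/
theorem homology_succ_eq_zero_of_free {X Y : Type u} [AddCommGroup X] [Module k X]
    [AddCommGroup Y] [Module k Y] (ρ : Representation k G X)
    (c : X →ₗ[k] (G →₀ Y)) (p : Y →ₗ[k] X)
    (hc : ∀ g, c ∘ₗ ρ g = Finsupp.lmapDomain Y k (g * ·) ∘ₗ c)
    (hp : Finsupp.lsum k (fun g => ρ g ∘ₗ p) ∘ₗ c = LinearMap.id)
    (n : ℕ) (x : groupHomology (Rep.of ρ) (n + 1)) : x = 0 := by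
  let R := Rep.res (⊥ : Subgroup G).subtype (Rep.of ρ)
  let I := Rep.ind (⊥ : Subgroup G).subtype R
  let mk : G → X →ₗ[k] I.V := fun h => Representation.IndV.mk (⊥ : Subgroup G).subtype R.ρ h
  let i : (G →₀ Y) →ₗ[k] I.V := Finsupp.lsum k (fun g => mk g⁻¹ ∘ₗ p)
  have hmk : ∀ g h x, I.ρ g (mk h x) = mk (h * g⁻¹) x := fun g h x =>
    Representation.ind_mk _ R.ρ g h x
  have hi : ∀ g, I.ρ g ∘ₗ i = i ∘ₗ Finsupp.lmapDomain Y k (g * ·) := by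
    intro g
    ext h y
    simp only [i, LinearMap.comp_apply, Finsupp.lsingle_apply, Finsupp.lmapDomain_apply,
      Finsupp.mapDomain_single, Finsupp.lsum_single, hmk, mul_inv_rev]
  have hj : IsEquivariant (Rep.of ρ) I (MonoidHom.id G) (i ∘ₗ c) := by
    intro g x
    have h1 := LinearMap.congr_fun (hc g) x
    have h2 := LinearMap.congr_fun (hi g) (c x)
    simp only [LinearMap.comp_apply] at h1 h2 ⊢
    rw [h1, ← h2]
    rfl
  let q' : I ⟶ Rep.of ρ := (Rep.indResHomEquiv (⊥ : Subgroup G).subtype R (Rep.of ρ)).symm (𝟙 R)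
  let q : I.V →ₗ[k] X := q'.hom.toLinearMap
  have hq : IsEquivariant I (Rep.of ρ) (MonoidHom.id G) q := fun g x => Rep.hom_comm_apply q' g x
  have hqmk : ∀ h x, q (mk h x) = ρ h⁻¹ x := by
    intro h x
    have h1 : q (mk 1 x) = x := congrArg (fun t => t.hom x)
      ((Rep.indResHomEquiv (⊥ : Subgroup G).subtype R (Rep.of ρ)).apply_symm_apply (𝟙 R))
    have h2 := hq h⁻¹ (mk 1 x)
    rwa [hmk, one_mul, inv_inv, h1] at h2
  have hqi : q ∘ₗ i = Finsupp.lsum k (fun g => ρ g ∘ₗ p) := by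
    ext h y
    simp only [i, LinearMap.comp_apply, Finsupp.lsingle_apply, Finsupp.lsum_single, hqmk, inv_inv]
  have hqj : q ∘ₗ (i ∘ₗ c) = LinearMap.id := by
    rw [← LinearMap.comp_assoc, hqi, hp]
  rw [← hmap_hmap_eq_self hq hj rfl hqj (n + 1) x]
  have := ModuleCat.subsingleton_of_isZero (isZero_ind (Rep.of ρ) n)
  rw [Subsingleton.elim (hmap hj (n + 1) x) 0, map_zero]

end Acyclic

section Permutation

variable {k E Q : Type u} [CommRing k] [Group E] [Group Q]

/-- The representation `k[Q] ⊗ A` of `E` with the diagonal action, where `E` acts on `Q` by left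
translation through `π`; its elements are written as finitely supported functions `Q → A`. -/
def permAction (π : E →* Q) {V : Type u} [AddCommGroup V] [Module k V]
    (ρ : Representation k E V) : Representation k E (Q →₀ V) where
  toFun e := Finsupp.mapRange.linearMap (ρ e) ∘ₗ Finsupp.lmapDomain V k (π e * ·)
  map_one' := by
    ext q a : 2
    simp
  map_mul' e e' := by
    ext q a : 2
    simp [mul_assoc]

/-- `permAction` as an object of `Rep`. -/
abbrev permRep (π : E →* Q) (A : Rep.{u} k E) : Rep.{u} k E := Rep.of (permAction π A.ρ)

/-- The free representation `k[E] ⊗ B` on a module `B`. -/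
abbrev freeRep (k E : Type u) [CommRing k] [Group E] (B : Type u) [AddCommGroup B] [Module k B] :
    Rep.{u} k E :=
  permRep (MonoidHom.id E) (Rep.trivial k E B)

variable (π : E →* Q) (A : Rep.{u} k E)

@[simp]
theorem permAction_single {V : Type u} [AddCommGroup V] [Module k V] (ρ : Representation k E V)
    (e : E) (q : Q) (a : V) :
    permAction π ρ e (Finsupp.single q a) = Finsupp.single (π e * q) (ρ e a) := by
  simp [permAction]

/-- Equivariance of a map out of `k[Q] ⊗ A` can be tested on the elements `q ⊗ a`. -/
theorem isEquivariant_of_single {π : E →* Q} {A : Rep.{u} k E} {G : Type u} [Group G]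
    {C : Rep.{u} k G} {f : E →* G} {u : (Q →₀ A.V) →ₗ[k] C.V}
    (h : ∀ e q a, u (Finsupp.single (π e * q) (A.ρ e a)) = C.ρ (f e) (u (Finsupp.single q a))) :
    IsEquivariant (permRep π A) C f u := by
  intro e x
  have : u ∘ₗ permAction π A.ρ e = C.ρ (f e) ∘ₗ u := by
    ext q a
    simpa using h e q a
  exact LinearMap.congr_fun this x

/-- The functor `A ↦ k[Q] ⊗ A` applied to a short exact sequence. -/
def ShortSeq.perm {A B C : Rep.{u} k E} (S : ShortSeq A B C) :
    ShortSeq (permRep π A) (permRep π B) (permRep π C) where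
  inc := Finsupp.mapRange.linearMap S.inc
  proj := Finsupp.mapRange.linearMap S.proj
  inc_equi := isEquivariant_of_single fun e q a => by simp [S.inc_equi e a]
  proj_equi := isEquivariant_of_single fun e q a => by simp [S.proj_equi e a]
  inc_injective := Finsupp.mapRange_injective _ (map_zero _) S.inc_injective
  proj_surjective := Finsupp.mapRange_surjective _ (map_zero _) S.proj_surjective
  exact := by
    rw [LinearMap.exact_iff, Finsupp.ker_mapRange, Finsupp.range_mapRange_linearMap _
      (LinearMap.ker_eq_bot.2 S.inc_injective), S.exact.linearMap_ker_eq]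

/-- The free cover `k[E] ⊗ A → A` of a representation. -/
def coverMap : (E →₀ A.V) →ₗ[k] A.V :=
  Finsupp.lsum k fun e => A.ρ e

@[simp]
theorem coverMap_single (e : E) (a : A.V) : coverMap A (Finsupp.single e a) = A.ρ e a := by
  rw [coverMap, Finsupp.lsum_single]

theorem coverMap_isEquivariant :
    IsEquivariant (freeRep k E A.V) A (MonoidHom.id E) (coverMap A) :=
  isEquivariant_of_single fun e q a => by simp

theorem coverMap_surjective : Function.Surjective (coverMap A) := fun a =>
  ⟨Finsupp.single 1 a, by rw [coverMap_single, map_one]; rfl⟩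

/-- The kernel of the free cover. -/
def syzygy : Rep.{u} k E :=
  Rep.subrepresentation (freeRep k E A.V)
    (LinearMap.ker (coverMap A)) fun e x hx => by
      rw [Submodule.mem_comap, LinearMap.mem_ker, coverMap_isEquivariant A e x,
        LinearMap.mem_ker.1 hx, map_zero]

/-- The short exact sequence of the free cover of `A`. -/
def coverSeq : ShortSeq (syzygy A) (freeRep k E A.V) A where
  inc := (LinearMap.ker (coverMap A)).subtype
  proj := coverMap A
  inc_equi _ _ := rfl
  proj_equi := coverMap_isEquivariant A
  inc_injective := Subtype.val_injective
  proj_surjective := coverMap_surjective A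
  exact := LinearMap.exact_subtype_ker_map (coverMap A)

variable (B : Type u) [AddCommGroup B] [Module k B] (n : ℕ)

theorem homology_succ_free_eq_zero (x : groupHomology (freeRep k E B) (n + 1)) : x = 0 := by
  refine homology_succ_eq_zero_of_free _ (Y := B) LinearMap.id (Finsupp.lsingle 1) ?_ ?_ n x
  · intro g
    ext q a : 2
    simp
  · ext q a : 2
    simp

/-- Restricting a free representation to a subgroup leaves it acyclic. -/
theorem homology_succ_res_free_eq_zero (N : Subgroup E)
    (x : groupHomology (Rep.res N.subtype (freeRep k E B)) (n + 1)) : x = 0 := by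
  -- `r e` is the component in `N` of `e` with respect to a transversal of the cosets `N e`.
  obtain ⟨r, hr⟩ : ∃ r : E → N, ∀ (g : N) e, r (g * e) = g * r e := by
    obtain ⟨T, hT, -⟩ := N.exists_isComplement_right 1
    refine ⟨fun e => (hT.equiv e).1, fun g e => ?_⟩
    simp only [hT.equiv_mul_left]
  refine homology_succ_eq_zero_of_free _ (Y := E →₀ B)
    (Finsupp.lsum k fun e => Finsupp.lsingle (r e) ∘ₗ Finsupp.lsingle ((r e : E)⁻¹ * e))
    LinearMap.id ?_ ?_ n x
  · intro g
    ext q a : 2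
    simp [hr, mul_assoc]
  · ext q a : 2
    simp

/-- The tensor product of a permutation representation with a free one is acyclic, as
`e ⊗ q ↦ e ⊗ π(e)⁻¹ q` untwists the diagonal action. -/
theorem homology_succ_perm_free_eq_zero
    (x : groupHomology (permRep π (freeRep k E B)) (n + 1)) : x = 0 := by
  refine homology_succ_eq_zero_of_free _ (Y := Q →₀ E →₀ B)
    (Finsupp.lsum k fun q => Finsupp.lsum k fun e =>
      Finsupp.lsingle e ∘ₗ Finsupp.lsingle ((π e)⁻¹ * q) ∘ₗ Finsupp.lsingle 1)
    LinearMap.id ?_ ?_ n x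
  · intro g
    ext q e b : 3
    simp only [LinearMap.comp_apply, Finsupp.lsingle_apply, permAction_single, Finsupp.lsum_single]
    simp [mul_assoc]
  · ext q e b : 3
    simp only [LinearMap.comp_apply, Finsupp.lsingle_apply, Finsupp.lsum_single, LinearMap.id_apply]
    simp

end Permutation

/-! ### Shapiro's lemma for a normal subgroup -/

section Shapiro

variable {k E Q : Type u} [CommRing k] [Group E] [Group Q] (π : E →* Q) (A : Rep.{u} k E)

/-- The inclusion `A → k[Q] ⊗ A`, `a ↦ 1 ⊗ a`, is equivariant for the kernel of `E → Q`. -/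
theorem single_one_isEquivariant :
    IsEquivariant (Rep.res π.ker.subtype A) (permRep π A) π.ker.subtype (Finsupp.lsingle 1) := by
  intro g x
  have h : π g = 1 := g.2
  simp [h]

/-- Injectivity in degree zero: a section `s` of `π` gives a retraction `q ⊗ a ↦ s(q)⁻¹ a` of the
coinvariants. -/
theorem hmap_single_one_zero_injective (hπ : Function.Surjective π) :
    Function.Injective (hmap (single_one_isEquivariant π A) 0) := by
  rw [injective_iff_map_eq_zero]
  intro x hx
  obtain ⟨a, rfl⟩ := zeroClass_surjective _ x
  rw [hmap_zeroClass, zeroClass_eq_zero_iff] at hx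
  rw [zeroClass_eq_zero_iff]
  obtain ⟨s, hs⟩ := hπ.hasRightInverse
  let mk := Representation.Coinvariants.mk (Rep.res π.ker.subtype A).ρ
  have hmk : ∀ (g : E) (_ : π g = 1) (b : A.V), mk (A.ρ g b) = mk b := fun g hg b =>
    Representation.Coinvariants.mk_self_apply (Rep.res π.ker.subtype A).ρ ⟨g, hg⟩ b
  let r : (Q →₀ A.V) →ₗ[k] _ := Finsupp.lsum k fun q => mk ∘ₗ A.ρ (s q)⁻¹
  have hr : ∀ e, r ∘ₗ (permRep π A).ρ e = r := by
    intro e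
    ext q b
    simp only [r, LinearMap.comp_apply, Finsupp.lsingle_apply, permAction_single,
      Finsupp.lsum_single]
    rw [← hmk ((s (π e * q))⁻¹ * e * s q) (by simp [hs _]) (A.ρ (s q)⁻¹ b)]
    simp [← Module.End.mul_apply, ← map_mul]
  have h1 := congrArg (Representation.Coinvariants.lift _ r hr) hx
  rw [map_zero, Representation.Coinvariants.lift_mk] at h1
  simp only [r, Finsupp.lsingle_apply, Finsupp.lsum_single, LinearMap.comp_apply] at h1
  rwa [hmk _ (by simp [hs _])] at h1

/-- The dimension shift for `hmap_single_one_surjective`. -/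
theorem hmap_single_one_surjective_succ {A P C : Rep.{u} k E} (S : ShortSeq A P C) (n : ℕ)
    (hA : Function.Surjective (hmap (single_one_isEquivariant π A) n))
    (hP : Function.Injective (hmap (single_one_isEquivariant π P) n))
    (hP' : ∀ x : groupHomology (permRep π P) (n + 1), x = 0) :
    Function.Surjective (hmap (single_one_isEquivariant π C) (n + 1)) := by
  intro x
  have hinc : (S.perm π).inc ∘ₗ Finsupp.lsingle 1 = Finsupp.lsingle 1 ∘ₗ S.inc :=
    LinearMap.ext fun x => Finsupp.mapRange_single (hf := map_zero _)
  have hproj : (S.perm π).proj ∘ₗ Finsupp.lsingle 1 = Finsupp.lsingle 1 ∘ₗ S.proj :=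
    LinearMap.ext fun x => Finsupp.mapRange_single (hf := map_zero _)
  have nat := (S.res π.ker.subtype).δ_naturality (S.perm π) (single_one_isEquivariant π A)
    (single_one_isEquivariant π P) (single_one_isEquivariant π C) hinc.symm hproj.symm n
  obtain ⟨y, hy⟩ := hA ((S.perm π).δ n x)
  have h0 : hmap (single_one_isEquivariant π P) n
      (hmap (S.res π.ker.subtype).inc_equi n y) = 0 := by
    rw [hmap_hmap_eq (single_one_isEquivariant π P) (S.res π.ker.subtype).inc_equi
      (S.perm π).inc_equi (single_one_isEquivariant π A) rfl hinc.symm n y, hy]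
    exact ((S.perm π).exact_δ_inc n).apply_apply_eq_zero x
  obtain ⟨z, hz⟩ := ((S.res π.ker.subtype).exact_δ_inc n y).1 (hP (h0.trans (map_zero _).symm))
  refine ⟨z, ?_⟩
  have h2 : (S.perm π).δ n (x - hmap (single_one_isEquivariant π C) (n + 1) z) = 0 := by
    rw [map_sub, ← nat, hz, hy, sub_self]
  obtain ⟨w, hw⟩ := ((S.perm π).exact_proj_δ n _).1 h2
  rw [hP' w, map_zero] at hw
  exact (sub_eq_zero.1 hw.symm).symm

/-- The surjectivity half of Shapiro's lemma for the kernel of `E → Q`, by dimension shifting. -/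
theorem hmap_single_one_surjective (hπ : Function.Surjective π) (n : ℕ) :
    ∀ A : Rep.{u} k E, Function.Surjective (hmap (single_one_isEquivariant π A) n) := by
  induction n with
  | zero =>
    intro A x
    obtain ⟨a, rfl⟩ := zeroClass_surjective _ x
    change (Q →₀ A.V) at a
    induction a using Finsupp.induction_linear with
    | zero => exact ⟨0, by simp⟩
    | add a b ha hb =>
      obtain ⟨y, hy⟩ := ha
      obtain ⟨z, hz⟩ := hb
      exact ⟨y + z, by rw [map_add, hy, hz, map_add]⟩
    | single q a =>
      obtain ⟨e, rfl⟩ := hπ q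
      refine ⟨zeroClass _ (A.ρ e⁻¹ a), ?_⟩
      rw [hmap_zeroClass, ← zeroClass_smul e]
      congr 1
      simp [← Module.End.mul_apply, ← map_mul]
  | succ n ih =>
    intro A
    refine hmap_single_one_surjective_succ π (coverSeq A) n (ih _) ?_
      (homology_succ_perm_free_eq_zero π _ n)
    cases n with
    | zero => exact hmap_single_one_zero_injective π _ hπ
    | succ n =>
      rw [injective_iff_map_eq_zero]
      exact fun x _ => homology_succ_res_free_eq_zero _ n _ x

end Shapiro

/-! ### Generalized eigenvalues -/

section Eigen

variable {k T T' : Type*} [CommRing k] [AddCommGroup T] [Module k T] [AddCommGroup T'] [Module k T']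

theorem pow_sub_smul_map {α : Module.End k T} {β : Module.End k T'} {g : T →ₗ[k] T'}
    (h : ∀ x, g (α x) = β (g x)) (c : k) (e : ℕ) (x : T) :
    g (((α - c • 1) ^ e) x) = ((β - c • 1) ^ e) (g x) := by
  induction e generalizing x with
  | zero => simp
  | succ e ih => simp [pow_succ, ih, h]

theorem map_mem_maxGenEigenspace {α : Module.End k T} {β : Module.End k T'} {g : T →ₗ[k] T'}
    (h : ∀ x, g (α x) = β (g x)) {c : k} {x : T} (hx : x ∈ α.maxGenEigenspace c) :
    g x ∈ β.maxGenEigenspace c := by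
  rw [Module.End.mem_maxGenEigenspace] at hx ⊢
  obtain ⟨e, he⟩ := hx
  exact ⟨e, by rw [← pow_sub_smul_map h, he, map_zero]⟩

/-- Generalized eigenvectors are closed under extensions. -/
theorem mem_maxGenEigenspace_of_map {α : Module.End k T} {β : Module.End k T'} {g : T →ₗ[k] T'}
    (h : ∀ x, g (α x) = β (g x)) {c : k} {x : T} (hx : g x ∈ β.maxGenEigenspace c)
    (hg : ∀ y, g y = 0 → y ∈ α.maxGenEigenspace c) :
    x ∈ α.maxGenEigenspace c := by
  rw [Module.End.mem_maxGenEigenspace] at hx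
  obtain ⟨e, he⟩ := hx
  rw [← pow_sub_smul_map h] at he
  obtain ⟨e', he'⟩ := (Module.End.mem_maxGenEigenspace _ _ _).1 (hg _ he)
  refine (Module.End.mem_maxGenEigenspace _ _ _).2 ⟨e' + e, ?_⟩
  rwa [pow_add]

theorem smul_mem_maxGenEigenspace {α β : Module.End k T} {c d : k} (h : β = d • α) {x : T}
    (hx : x ∈ α.maxGenEigenspace c) : x ∈ β.maxGenEigenspace (d * c) := by
  rw [Module.End.mem_maxGenEigenspace] at hx ⊢
  obtain ⟨e, he⟩ := hx
  refine ⟨e, ?_⟩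
  have : β - (d * c) • 1 = d • (α - c • 1) := by rw [h, smul_sub, mul_smul]
  rw [this, smul_pow, LinearMap.smul_apply, he, smul_zero]

end Eigen

/-! ### Power maps on the homology of an abelian group -/

section Weight

variable (k : Type u) [CommRing k]

/-- The power maps `x ↦ x ^ m` of the group `N` act on `H_n(N, A)`, for trivial coefficients `A`,
with the single generalized eigenvalue `m ^ n`. -/
def HasPowWeight (N : Type u) [Group N] : Prop :=
  ∀ (A : Rep.{u} k N), (∀ g x, A.ρ g x = x) → ∀ (n m : ℕ) (ψ : N →* N), (∀ x, ψ x = x ^ m) →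
    ∀ (h : IsEquivariant A A ψ LinearMap.id) (x : groupHomology A n),
      x ∈ Module.End.maxGenEigenspace (hmap h n) ((m : k) ^ n)

variable {k}

theorem hasPowWeight_of_subsingleton (N : Type u) [Group N] [Subsingleton N] :
    HasPowWeight k N := by
  intro A _ n m ψ hψ h x
  cases n with
  | zero =>
    have : hmap h 0 = LinearMap.id :=
      LinearMap.ext fun x => hmap_hmap_eq_self (IsEquivariant.id A) h
        (MonoidHom.ext fun y => Subsingleton.elim _ _) rfl 0 x |>.symm.trans
          (hmap_id A 0 _) |>.symm
    rw [Module.End.mem_maxGenEigenspace]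
    exact ⟨1, by simp [this]⟩
  | succ n =>
    have := ModuleCat.subsingleton_of_isZero (isZero_groupHomology_succ_of_subsingleton A n)
    rw [Subsingleton.elim x 0]
    exact zero_mem _

end Weight

/-! ### Extensions by an infinite cyclic group -/

section Cyclic

variable {k E Q : Type u} [CommRing k] [CommGroup E] [CommGroup Q] (π : E →* Q)
  (A : Rep.{u} k E)

/-- Left translation by `t` on `k[Q] ⊗ V`, whose elements are finitely supported functions. -/
abbrev translate (k : Type u) [CommRing k] (V : Type u) [AddCommGroup V] [Module k V] (t : Q) :
    (Q →₀ V) →ₗ[k] (Q →₀ V) :=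
  Finsupp.lmapDomain V k (t * ·)

theorem translate_sub_id_injective {V : Type u} [AddCommGroup V] [Module k V] {t : Q}
    (ht : ¬ IsOfFinOrder t) :
    Function.Injective (translate k V t - (LinearMap.id : (Q →₀ V) →ₗ[k] (Q →₀ V))) := by
  rw [injective_iff_map_eq_zero]
  intro x hx
  have hinv : ∀ q, x (t * q) = x q := by
    intro q
    have h1 := DFunLike.congr_fun hx (t * q)
    simp only [LinearMap.sub_apply, Finsupp.lmapDomain_apply, LinearMap.id_apply,
      Finsupp.sub_apply, Finsupp.mapDomain_apply (mul_right_injective t), Finsupp.zero_apply,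
      sub_eq_zero] at h1
    exact h1.symm
  have hpow : ∀ (i : ℕ) q, x (t ^ i * q) = x q := by
    intro i
    induction i with
    | zero => simp
    | succ i ih => intro q; rw [pow_succ, mul_assoc, ih, hinv]
  by_contra hne
  obtain ⟨q, hq⟩ := Finsupp.ne_iff.1 hne
  have hmem : ∀ i : ℕ, t ^ i * q ∈ x.support := fun i => by
    rw [Finsupp.mem_support_iff, hpow]; exact hq
  have : Function.Injective fun i : ℕ => (⟨t ^ i * q, hmem i⟩ : x.support) := fun i j hij =>
    injective_pow_iff_not_isOfFinOrder.2 ht (mul_right_cancel (Subtype.ext_iff.1 hij))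
  exact not_injective_infinite_finite _ this

/-- The sum of the coefficients. -/
abbrev augmentation (k Q : Type u) [CommRing k] (V : Type u) [AddCommGroup V] [Module k V] :
    (Q →₀ V) →ₗ[k] V :=
  Finsupp.lsum k fun _ => LinearMap.id

theorem exact_translate_sub_id {V : Type u} [AddCommGroup V] [Module k V] {t : Q}
    (ht : ∀ q, q ∈ Subgroup.zpowers t) :
    Function.Exact (translate k V t - (LinearMap.id : (Q →₀ V) →ₗ[k] (Q →₀ V)))
      (augmentation k Q V) := by
  have hadj : ∀ q (b : V), Finsupp.single (t * q) b - Finsupp.single q b ∈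
      LinearMap.range (translate k V t - (LinearMap.id : (Q →₀ V) →ₗ[k] (Q →₀ V))) := fun q b =>
    ⟨Finsupp.single q b, by simp⟩
  have hsingle : ∀ q (b : V), Finsupp.single q b - Finsupp.single 1 b ∈
      LinearMap.range (translate k V t - (LinearMap.id : (Q →₀ V) →ₗ[k] (Q →₀ V))) := by
    intro q b
    obtain ⟨i, rfl⟩ := ht q
    induction i with
    | zero => simp
    | succ i ih =>
      have := add_mem (hadj (t ^ (i : ℤ)) b) ih
      rwa [sub_add_sub_cancel, ← zpow_one_add, add_comm] at this
    | pred i ih =>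
      have := sub_mem ih (hadj (t ^ (-(i : ℤ) - 1)) b)
      rw [← zpow_one_add, add_sub_cancel] at this
      simpa using this
  have hall : ∀ x : Q →₀ V, x - Finsupp.single 1 (augmentation k Q V x) ∈
      LinearMap.range (translate k V t - (LinearMap.id : (Q →₀ V) →ₗ[k] (Q →₀ V))) := by
    intro x
    induction x using Finsupp.induction_linear with
    | zero => simp
    | add x y hx hy =>
      have := add_mem hx hy
      rwa [map_add, Finsupp.single_add, add_sub_add_comm]
    | single q b => simpa using hsingle q b
  intro x
  constructor
  · intro hx
    have := hall x
    rw [hx, Finsupp.single_zero, sub_zero] at this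
    exact this
  · rintro ⟨y, rfl⟩
    induction y using Finsupp.induction_linear with
    | zero => simp
    | add x y hx hy => rw [map_add, map_add, hx, hy, add_zero]
    | single q b =>
      rw [LinearMap.sub_apply, map_sub]
      simp

/-- The sequence `0 → k[Q] ⊗ A → k[Q] ⊗ A → A → 0` for an infinite cyclic group `Q` generated by
`t`, with `t - 1` as its first map. -/
def cyclicSeq {t : Q} (ht : ∀ q, q ∈ Subgroup.zpowers t)
    (ht' : ¬ IsOfFinOrder t) : ShortSeq (permRep π A) (permRep π A) A where
  inc := translate k A.V t - LinearMap.id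
  proj := augmentation k Q A.V
  inc_equi := isEquivariant_of_single fun e q a => by simp [mul_left_comm]
  proj_equi := isEquivariant_of_single fun e q a => by simp
  inc_injective := translate_sub_id_injective ht'
  proj_surjective a := ⟨Finsupp.single 1 a, by simp⟩
  exact := exact_translate_sub_id ht

variable {A} {m : ℕ} {ψ : E →* E}

/-- The map `q ↦ q ^ m` on `k[Q] ⊗ A`. -/
theorem powMap_isEquivariant (hA : ∀ g x, A.ρ g x = x) (hψ : ∀ x, ψ x = x ^ m) :
    IsEquivariant (permRep π A) (permRep π A) ψ (Finsupp.lmapDomain A.V k (· ^ m)) :=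
  isEquivariant_of_single fun e q a => by
    have : π (ψ e) = π e ^ m := by rw [hψ, map_pow]
    simp [this, mul_pow, hA]

/-- Translations of `k[Q] ⊗ A` act trivially on homology, because elements of `E` act as such. Hence
the sum of `j` of them, composed with the map `q ↦ q ^ m`, acts as `j` times that map. -/
theorem exists_hmap_sum_translate (hπ : Function.Surjective π) (hA : ∀ g x, A.ρ g x = x)
    (hψ : ∀ x, ψ x = x ^ m) (t : Q) (j n : ℕ) :
    ∃ h : IsEquivariant (permRep π A) (permRep π A) ψ
      ((∑ i ∈ Finset.range j, translate k A.V (t ^ i)) ∘ₗ Finsupp.lmapDomain A.V k (· ^ m)),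
      hmap h n = (j : k) • hmap (powMap_isEquivariant π hA hψ) n := by
  induction j with
  | zero =>
    have h0 : IsEquivariant (permRep π A) (permRep π A) ψ (0 : (Q →₀ A.V) →ₗ[k] (Q →₀ A.V)) :=
      fun g x => by simp
    have h1 : hmap h0 n = 0 := by
      ext x
      have := hmap_add h0 h0 n x
      rw [hmap_congr (h0.add h0) h0 rfl (add_zero _)] at this
      simpa using this
    simp only [Finset.range_zero, Finset.sum_empty, LinearMap.zero_comp, Nat.cast_zero, zero_smul]
    exact ⟨h0, h1⟩
  | succ j ih =>
    obtain ⟨h, hh⟩ := ih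
    obtain ⟨e, he⟩ := hπ (t ^ j)
    have hact : (permRep π A).ρ e = translate k A.V (t ^ j) := by
      ext q a : 2
      simp [he, hA]
    have h1 : IsEquivariant (permRep π A) (permRep π A) ψ
        (translate k A.V (t ^ j) ∘ₗ Finsupp.lmapDomain A.V k (· ^ m)) :=
      isEquivariant_of_single fun e q a => by
        have : π (ψ e) = π e ^ m := by rw [hψ, map_pow]
        simp [this, mul_pow, hA, mul_left_comm]
    have h2 : hmap h1 n = hmap (powMap_isEquivariant π hA hψ) n := by
      ext x
      rw [← hmap_conj (permRep π A) e n (hmap (powMap_isEquivariant π hA hψ) n x)]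
      refine (hmap_hmap_eq_hmap _ _ _ ?_ ?_ n x).symm
      · ext x
        simp
      · rw [hact]
    simp only [Finset.sum_range_succ, LinearMap.add_comp]
    refine ⟨h.add h1, ?_⟩
    ext x
    rw [hmap_add h h1, hh, h2, Nat.cast_succ, add_smul, one_smul]
    rfl

/-- The weight of `E` from that of the kernel of a map onto an infinite cyclic group, by the long
exact homology sequence of `cyclicSeq`. As `t ^ m - 1 = (t - 1) (1 + t + ⋯ + t ^ (m - 1))`, the
connecting map carries the action of `x ↦ x ^ m` to `m` times the one on `H_n(E, k[Q] ⊗ A)`, which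
accounts for the step from `m ^ n` to `m ^ (n + 1)`. -/
theorem HasPowWeight.of_cyclic_quotient (hπ : Function.Surjective π) {t : Q}
    (ht : ∀ q, q ∈ Subgroup.zpowers t) (ht' : ¬ IsOfFinOrder t)
    (hN : HasPowWeight k π.ker) : HasPowWeight k E := by
  intro A hA n m ψ hψ h x
  let ψN : π.ker →* π.ker := (ψ.comp π.ker.subtype).codRestrict π.ker fun x => by
    have : π x = 1 := x.2
    simp [hψ, MonoidHom.mem_ker, this]
  have hψN : ∀ x, ψN x = x ^ m := fun x => Subtype.ext (hψ x)
  let σ := powMap_isEquivariant π hA hψ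
  -- the weight on the homology of `k[Q] ⊗ A`, by Shapiro's lemma
  have key : ∀ (n : ℕ) (x : groupHomology (permRep π A) n),
      x ∈ Module.End.maxGenEigenspace (hmap σ n) ((m : k) ^ n) := by
    intro n x
    obtain ⟨y, rfl⟩ := hmap_single_one_surjective π hπ n A x
    have hN' : IsEquivariant (Rep.res π.ker.subtype A) (Rep.res π.ker.subtype A) ψN
      LinearMap.id := fun g x => (hA _ _).trans (hA _ _).symm
    have h1 := hN (Rep.res π.ker.subtype A) (fun g x => hA _ _) n m ψN hψN hN' y
    have hc : Finsupp.lsingle 1 ∘ₗ LinearMap.id =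
        Finsupp.lmapDomain A.V k (fun q : Q => q ^ m) ∘ₗ Finsupp.lsingle 1 := by
      ext a : 1
      simp
    exact map_mem_maxGenEigenspace
      (hmap_hmap_eq (single_one_isEquivariant π A) hN' σ (single_one_isEquivariant π A) rfl hc n) h1
  let S := cyclicSeq π A ht ht'
  have hbc : LinearMap.id ∘ₗ S.proj = S.proj ∘ₗ Finsupp.lmapDomain A.V k (· ^ m) := by
    ext q a
    simp [S, cyclicSeq]
  have hproj : ∀ n y, hmap S.proj_equi n y ∈
      Module.End.maxGenEigenspace (hmap h n) ((m : k) ^ n) := fun n y =>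
    map_mem_maxGenEigenspace (fun y => hmap_hmap_eq S.proj_equi σ h S.proj_equi rfl hbc.symm n y)
      (key n y)
  cases n with
  | zero =>
    obtain ⟨a, rfl⟩ := zeroClass_surjective _ x
    obtain ⟨b, rfl⟩ := S.proj_surjective a
    rw [← hmap_zeroClass S.proj_equi]
    exact hproj 0 _
  | succ n =>
    obtain ⟨hτ, hτn⟩ := exists_hmap_sum_translate π hπ hA hψ t m n
    -- `t ^ m - 1` is `t - 1` times the sum of the first `m` powers of `t`
    have hab : Finsupp.lmapDomain A.V k (· ^ m) ∘ₗ S.inc = S.inc ∘ₗ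
        ((∑ i ∈ Finset.range m, translate k A.V (t ^ i)) ∘ₗ Finsupp.lmapDomain A.V k (· ^ m)) := by
      have : ∀ j, (translate k A.V t - LinearMap.id) ∘ₗ
          (∑ i ∈ Finset.range j, translate k A.V (t ^ i)) =
          translate k A.V (t ^ j) - LinearMap.id := by
        intro j
        induction j with
        | zero => ext q a : 2; simp
        | succ j ih =>
          rw [Finset.sum_range_succ, LinearMap.comp_add, ih]
          ext q a : 2
          simp [pow_succ', mul_assoc]
      rw [← LinearMap.comp_assoc]
      refine Eq.trans ?_ (congrArg (· ∘ₗ Finsupp.lmapDomain A.V k (· ^ m)) (this m).symm)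
      have hinc : S.inc = translate k A.V t - LinearMap.id := rfl
      rw [hinc, LinearMap.comp_sub]
      ext q a : 2
      simp [mul_pow]
    refine mem_maxGenEigenspace_of_map (g := S.δ n) (β := hmap hτ n)
      (fun y => (S.δ_naturality S hτ σ h hab hbc n y).symm) ?_ ?_
    · rw [pow_succ']
      exact smul_mem_maxGenEigenspace hτn (key n _)
    · intro y hy
      obtain ⟨z, rfl⟩ := (S.exact_proj_δ n y).1 hy
      exact hproj _ z

end Cyclic

/-! ### Torsion-free abelian groups -/

section Fg

variable {k N : Type u} [CommRing k] [Group N]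

theorem res_subtype_isEquivariant (A : Rep.{u} k N) (L : Subgroup N) :
    IsEquivariant (Rep.res L.subtype A) A L.subtype LinearMap.id := fun _ _ => rfl

/-- Group homology is the union of the images of the homology of finitely generated subgroups,
since a chain involves only finitely many group elements. -/
theorem exists_fg_hmap_eq (A : Rep.{u} k N) (n : ℕ) (x : groupHomology A n) :
    ∃ L : Subgroup N, L.FG ∧ ∃ y : groupHomology (Rep.res L.subtype A) n,
      hmap (res_subtype_isEquivariant A L) n y = x := by
  induction x using groupHomology_induction_on with
  | h z =>
  let f : (Fin n → N) →₀ A.V := groupHomology.iCycles A n z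
  let s : Set N := ⋃ g ∈ f.support, Set.range g
  have hs : s.Finite := f.support.finite_toSet.biUnion fun g _ => Set.finite_range g
  let L := Subgroup.closure s
  refine ⟨L, (Subgroup.fg_iff L).2 ⟨s, rfl, hs⟩, ?_⟩
  let c := groupHomology.chainsMap L.subtype (res_subtype_isEquivariant A L).toHom
  have hmono : ∀ i, Function.Injective (c.f i) := fun i => by
    have : Mono (res_subtype_isEquivariant A L).toHom :=
      (Rep.mono_iff_injective _).2 Function.injective_id
    exact (ModuleCat.mono_iff_injective _).1
      (groupHomology.chainsMap_f_map_mono _ _ L.subtype_injective i)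
  obtain ⟨f', hf'⟩ : ∃ f' : (Fin n → L) →₀ A.V, c.f n f' = f := by
    have hmem : ∀ g ∈ f.support, ∀ i, g i ∈ L := fun g hg i =>
      Subgroup.subset_closure (Set.mem_biUnion hg ⟨i, rfl⟩)
    let cn : ((Fin n → L) →₀ A.V) →ₗ[k] ((Fin n → N) →₀ A.V) := (c.f n).hom
    have hcn : ∀ g a, cn (Finsupp.single g a) = Finsupp.single (fun i => (g i : N)) a :=
      groupHomology.chainsMap_f_single L.subtype (res_subtype_isEquivariant A L).toHom n
    refine ⟨∑ g ∈ f.support.attach,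
      Finsupp.single (fun i => ⟨g.1 i, hmem g.1 g.2 i⟩) (f g.1), ?_⟩
    change cn _ = f
    rw [map_sum]
    simp only [hcn]
    refine Eq.trans ?_ f.sum_single
    exact Finset.sum_attach f.support fun g => Finsupp.single g (f g)
  have hd : (groupHomology.inhomogeneousChains (Rep.res L.subtype A)).d n
      ((ComplexShape.down ℕ).next n) f' = 0 := by
    refine hmono _ ?_
    have h1 := congrArg (fun t => t.hom f') (c.comm n ((ComplexShape.down ℕ).next n))
    refine Eq.trans h1.symm ?_
    have h2 : (groupHomology.inhomogeneousChains A).d n ((ComplexShape.down ℕ).next n)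
        (groupHomology.iCycles A n z) = 0 :=
      congrArg (fun t => t.hom z) ((groupHomology.inhomogeneousChains A).iCycles_d n
        ((ComplexShape.down ℕ).next n))
    rw [map_zero]
    exact (congrArg _ hf').trans h2
  refine ⟨groupHomology.π _ n (groupHomology.cyclesMk n _ rfl f' hd), ?_⟩
  have h3 := congrArg (fun t => t.hom (groupHomology.cyclesMk n _ rfl f' hd))
    (groupHomology.π_map L.subtype (res_subtype_isEquivariant A L).toHom n)
  refine Eq.trans h3 ?_
  refine congrArg (groupHomology.π A n) ?_
  have hi : Function.Injective (groupHomology.iCycles A n) :=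
    (ModuleCat.mono_iff_injective _).1 inferInstance
  refine hi ?_
  have h4 := congrArg (fun t => t.hom (groupHomology.cyclesMk n _ rfl f' hd))
    (HomologicalComplex.cyclesMap_i c n)
  have h5 := groupHomology.iCycles_mk (A := Rep.res L.subtype A) rfl f' hd
  exact Eq.trans h4 (Eq.trans (congrArg (fun t => (c.f n).hom t) h5) hf')

theorem HasPowWeight.of_fg (h : ∀ L : Subgroup N, L.FG → HasPowWeight k L) :
    HasPowWeight k N := by
  intro A hA n m ψ hψ hψA x
  obtain ⟨L, hL, y, rfl⟩ := exists_fg_hmap_eq A n x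
  let ψL : L →* L := (ψ.comp L.subtype).codRestrict L fun x => by
    rw [MonoidHom.comp_apply, hψ]
    exact pow_mem x.2 m
  have hL' : IsEquivariant (Rep.res L.subtype A) (Rep.res L.subtype A) ψL LinearMap.id :=
    fun g x => (hA _ _).trans (hA _ _).symm
  exact map_mem_maxGenEigenspace
    (hmap_hmap_eq (res_subtype_isEquivariant A L) hL' hψA (res_subtype_isEquivariant A L) rfl rfl n)
    (h L hL (Rep.res L.subtype A) (fun g x => hA _ _) n m ψL (fun x => Subtype.ext (hψ x)) hL' y)

end Fg

section TorsionFree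

variable {k : Type u} [CommRing k]

/-- The case of a free abelian group, by induction on the rank. -/
theorem hasPowWeight_of_addEquiv (r : ℕ) : ∀ (E : Type u) [CommGroup E],
    (Additive E ≃+ (Fin r → ℤ)) → HasPowWeight k E := by
  induction r with
  | zero =>
    intro E _ e
    have : Subsingleton E := (Additive.ofMul.trans e.toEquiv).subsingleton
    exact hasPowWeight_of_subsingleton E
  | succ r ih =>
    intro E _ e
    -- the first coordinate, with values in an infinite cyclic group in the universe of `E`
    let Q := Multiplicative (ULift.{u} ℤ)
    let π : E →* Q :=
      { toFun := fun x => Multiplicative.ofAdd (ULift.up (e (Additive.ofMul x) 0))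
        map_one' := by rw [ofMul_one, map_zero]; rfl
        map_mul' := fun x y => by rw [ofMul_mul, map_add]; rfl }
    have hker : ∀ x, x ∈ π.ker ↔ e (Additive.ofMul x) 0 = 0 := fun x => by
      rw [MonoidHom.mem_ker]
      exact ⟨fun h => congrArg (fun q : Q => (Multiplicative.toAdd q).down) h,
        fun h => congrArg (fun i : ℤ => (Multiplicative.ofAdd (ULift.up.{u} i) : Q)) h⟩
    have hπ : Function.Surjective π := fun q => by
      refine ⟨Additive.toMul (e.symm fun _ => (Multiplicative.toAdd q).down), ?_⟩
      change Multiplicative.ofAdd (ULift.up (e (e.symm _) 0)) = q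
      rw [e.apply_symm_apply]
      rfl
    let e' : Additive π.ker →+ (Fin r → ℤ) :=
      { toFun := fun x i => e (Additive.ofMul (Additive.toMul x).1) i.succ
        map_zero' := by
          ext i
          simp
        map_add' := fun x y => by
          ext i
          simp }
    have he' : Function.Bijective e' := by
      constructor
      · rw [injective_iff_map_eq_zero]
        intro x hx
        have h1 : e (Additive.ofMul (Additive.toMul x).1) = 0 := by
          ext i
          refine Fin.cases ((hker _).1 (Additive.toMul x).2) (fun i => ?_) i
          exact congrFun hx i
        have h2 := (map_eq_zero_iff e e.injective).1 h1
        exact congrArg Additive.ofMul (Subtype.ext h2 : Additive.toMul x = 1)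
      · intro v
        have h1 : Additive.toMul (e.symm (Fin.cons 0 v : Fin (r + 1) → ℤ)) ∈ π.ker := by
          rw [hker]
          simp
        refine ⟨Additive.ofMul ⟨_, h1⟩, ?_⟩
        ext i
        simp [e']
    let t : Q := Multiplicative.ofAdd (ULift.up 1)
    have htpow : ∀ i : ℤ, t ^ i = Multiplicative.ofAdd (ULift.up i) := fun i => by
      rw [← ofAdd_zsmul]
      congr 1
      ext
      simp
    refine HasPowWeight.of_cyclic_quotient π hπ (t := t)
      (fun q => ⟨(Multiplicative.toAdd q).down, htpow _⟩) ?_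
      (ih π.ker (AddEquiv.ofBijective e' he'))
    rw [← injective_zpow_iff_not_isOfFinOrder]
    intro i j hij
    simp only [htpow] at hij
    exact congrArg (fun q : Q => (Multiplicative.toAdd q).down) hij

/-- A torsion-free abelian group is the union of its finitely generated, hence free, subgroups. -/
theorem hasPowWeight_of_torsionFree (N : Type u) [CommGroup N] [IsMulTorsionFree N] :
    HasPowWeight k N := by
  refine HasPowWeight.of_fg fun L hL => ?_
  have : Module.Finite ℤ (Additive L) := by
    rw [Module.Finite.iff_addGroup_fg]
    have := (Group.fg_iff_subgroup_fg L).2 hL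
    infer_instance
  have : Module.IsTorsionFree ℤ (Additive L) := inferInstance
  have : Module.Free ℤ (Additive L) := inferInstance
  exact hasPowWeight_of_addEquiv _ L (Module.finBasis ℤ (Additive L)).equivFun.toAddEquiv

end TorsionFree

/-! ### Differences of commuting automorphisms -/

section LinearAlgebra

variable {k T : Type*} [CommRing k] [AddCommGroup T] [Module k T]

/-- A locally nilpotent perturbation of an automorphism commuting with it is an automorphism. -/
theorem bijective_add_of_locally_nilpotent {u ν : Module.End k T} (hc : Commute u ν)
    (hu : Function.Bijective u) (hν : ∀ x, ∃ e : ℕ, (ν ^ e) x = 0) :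
    Function.Bijective (u + ν) := by
  have hcx : ∀ x, u (ν x) = ν (u x) := fun x => LinearMap.congr_fun hc.eq x
  constructor
  · rw [injective_iff_map_eq_zero]
    have : ∀ (e : ℕ) x, (ν ^ e) x = 0 → (u + ν) x = 0 → x = 0 := by
      intro e
      induction e with
      | zero => exact fun x hx _ => hx
      | succ e ih =>
        intro x hx h
        rw [pow_succ, Module.End.mul_apply] at hx
        have h1 : ν x = 0 := by
          refine ih _ hx ?_
          rw [LinearMap.add_apply, hcx, ← map_add, ← LinearMap.add_apply, h, map_zero]
        rw [LinearMap.add_apply, h1, add_zero] at h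
        exact (map_eq_zero_iff u hu.1).1 h
    intro x h
    obtain ⟨e, he⟩ := hν x
    exact this e x he h
  · have : ∀ (e : ℕ) x, (ν ^ e) x = 0 → ∃ y, (u + ν) y = x := by
      intro e
      induction e with
      | zero => exact fun x hx => ⟨0, by rw [map_zero]; exact hx.symm⟩
      | succ e ih =>
        intro x hx
        obtain ⟨y, rfl⟩ := hu.2 x
        -- `u y` differs from `(u + ν) y` by `ν y`, which has a smaller order of nilpotence
        have h1 : (ν ^ e) (ν y) = 0 := by
          rw [← Module.End.mul_apply, ← pow_succ]
          refine (map_eq_zero_iff u hu.1).1 (Eq.trans ?_ hx)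
          exact LinearMap.congr_fun (hc.pow_right (e + 1)).eq y
        obtain ⟨z, hz⟩ := ih _ h1
        exact ⟨y - z, by rw [map_sub, hz, LinearMap.add_apply, add_sub_cancel_right]⟩
    intro x
    obtain ⟨e, he⟩ := hν x
    exact this e x he

/-- For `n ≥ 1`, commuting automorphisms `α m` with the single generalized eigenvalue `m ^ n` differ
from each other by automorphisms. Nothing is assumed about `k`: that `α m` is invertible already
forces `m` to be invertible on the module. -/
theorem bijective_sub_of_maxGenEigenspace {α : ℕ+ → Module.End k T} {n : ℕ} (hn : n ≠ 0)
    (hα : ∀ m, Function.Bijective (α m)) (hcomm : ∀ p q, Commute (α p) (α q))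
    (hw : ∀ m x, x ∈ (α m).maxGenEigenspace (((m : ℕ) : k) ^ n)) {p q : ℕ+} (hpq : p ≠ q) :
    Function.Bijective (α p - α q) := by
  have hsc : ∀ (c : k) (β : Module.End k T), Commute (c • (1 : Module.End k T)) β := fun c β =>
    (Commute.one_left β).smul_left c
  have hnil : ∀ m x, ∃ e : ℕ, ((α m - ((m : ℕ) : k) ^ n • 1) ^ e) x = 0 := fun m x =>
    (Module.End.mem_maxGenEigenspace _ _ _).1 (hw m x)
  have hnil' : ∀ m x, ∃ e : ℕ, ((-(α m - ((m : ℕ) : k) ^ n • 1)) ^ e) x = 0 := fun m x => by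
    obtain ⟨e, he⟩ := hnil m x
    exact ⟨e, by rw [neg_pow, Module.End.mul_apply, he, map_zero]⟩
  have hdiv : ∀ d : ℕ, d ≠ 0 → Function.Bijective ((d : k) • (1 : Module.End k T)) := by
    intro d hd
    -- `d ^ n` is a locally nilpotent perturbation of the automorphism `α d`
    let m : ℕ+ := ⟨d, Nat.pos_of_ne_zero hd⟩
    have h1 := bijective_add_of_locally_nilpotent
      (((Commute.refl (α m)).sub_right (hsc ((m : k) ^ n) (α m)).symm).neg_right) (hα m) (hnil' m)
    have h2 : α m + -(α m - ((m : ℕ) : k) ^ n • 1) = (d : k) ^ n • 1 := by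
      rw [neg_sub, add_sub_cancel]
      rfl
    rw [h2] at h1
    obtain ⟨n, rfl⟩ := Nat.exists_eq_succ_of_ne_zero hn
    constructor
    · refine Function.Injective.of_comp (f := ((d : k) ^ n • (1 : Module.End k T))) ?_
      convert h1.1 using 1
      ext x
      simp [pow_succ, mul_smul]
    · refine Function.Surjective.of_comp (g := ((d : k) ^ n • (1 : Module.End k T))) ?_
      convert h1.2 using 1
      ext x
      simp [pow_succ', mul_smul]
  wlog h : q < p generalizing p q
  · have h1 := this hpq.symm (lt_of_le_of_ne (not_lt.1 h) hpq)
    rw [← neg_sub]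
    exact (Equiv.neg T).bijective.comp h1
  have hlt : (q : ℕ) ^ n < (p : ℕ) ^ n := Nat.pow_lt_pow_left h hn
  have h0 := hdiv ((p : ℕ) ^ n - (q : ℕ) ^ n) (Nat.sub_pos_of_lt hlt).ne'
  rw [Nat.cast_sub hlt.le, Nat.cast_pow, Nat.cast_pow, sub_smul] at h0
  have h1 := bijective_add_of_locally_nilpotent
    ((hsc _ _).sub_left (hsc _ _)) h0 (hnil p)
  -- `α p - α q` is a locally nilpotent perturbation of `α p - q ^ n`, and the latter one of
  -- `p ^ n - q ^ n`
  have h2 : Commute (α p - ((q : ℕ) : k) ^ n • 1) (-(α q - ((q : ℕ) : k) ^ n • 1)) :=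
    (((hcomm p q).sub_right (hsc _ _).symm).sub_left (hsc _ _)).neg_right
  have h3 : ((p : ℕ) : k) ^ n • (1 : Module.End k T) - ((q : ℕ) : k) ^ n • 1 +
      (α p - ((p : ℕ) : k) ^ n • 1) = α p - ((q : ℕ) : k) ^ n • 1 := by abel
  rw [h3] at h1
  have h4 := bijective_add_of_locally_nilpotent h2 h1 (hnil' q)
  convert h4 using 2
  abel

end LinearAlgebra

/-! ### Homology of a split extension -/

section Split

variable {k E Q : Type u} [CommRing k] [Group E] [Group Q] {π : E →* Q} {s : Q →* E}

theorem isEquivariant_inflate (π : E →* Q) (A : Rep.{u} k Q) :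
    IsEquivariant (Rep.res π A) A π LinearMap.id := fun _ _ => rfl

theorem isEquivariant_section (hs : ∀ q, π (s q) = q) (A : Rep.{u} k Q) :
    IsEquivariant A (Rep.res π A) s LinearMap.id := fun q x => by
  change A.ρ q x = A.ρ (π (s q)) x
  rw [hs]

/-- An endomorphism `φ` of `E` over `Q` acts on homology with coefficients inflated from `Q`. -/
theorem isEquivariant_over {φ : E →* E} (hφ : ∀ x, π (φ x) = π x) (A : Rep.{u} k Q) :
    IsEquivariant (Rep.res π A) (Rep.res π A) φ LinearMap.id := fun g x => by
  change A.ρ (π g) x = A.ρ (π (φ g)) x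
  rw [hφ]

theorem hmap_inflate_zero_injective (hπ : Function.Surjective π) (A : Rep.{u} k Q) :
    Function.Injective (hmap (isEquivariant_inflate π A) 0) := by
  rw [injective_iff_map_eq_zero]
  intro x hx
  obtain ⟨a, rfl⟩ := zeroClass_surjective _ x
  rw [hmap_zeroClass, zeroClass_eq_zero_iff] at hx
  rw [zeroClass_eq_zero_iff]
  let mk := Representation.Coinvariants.mk (Rep.res π A).ρ
  have hmk : ∀ q, mk ∘ₗ A.ρ q = mk := fun q => by
    obtain ⟨e, rfl⟩ := hπ q
    ext b
    exact Representation.Coinvariants.mk_self_apply (Rep.res π A).ρ e b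
  have h1 := congrArg (Representation.Coinvariants.lift _ mk hmk) hx
  rwa [map_zero, Representation.Coinvariants.lift_mk] at h1

variable (hs : ∀ q, π (s q) = q) {φ : ℕ+ →* MulAut E} (hφπ : ∀ m x, π (φ m x) = π x)

/-- The map induced by `φ m` on the homology of `E` with coefficients inflated from `Q`. -/
def twist (hφπ : ∀ m x, π (φ m x) = π x) (A : Rep.{u} k Q) (n : ℕ) (m : ℕ+) :
    Module.End k (groupHomology (Rep.res π A) n) :=
  hmap (isEquivariant_over (φ := (φ m).toMonoidHom) (hφπ m) A) n

theorem twist_mul (A : Rep.{u} k Q) (n : ℕ) (p q : ℕ+) :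
    twist hφπ A n (p * q) = twist hφπ A n p * twist hφπ A n q := by
  ext x
  have h : (φ p).toMonoidHom.comp (φ q).toMonoidHom = (φ (p * q)).toMonoidHom := by
    ext y
    simp
  exact (hmap_hmap_eq_hmap (isEquivariant_over (φ := (φ p).toMonoidHom) (hφπ p) A)
    (isEquivariant_over (φ := (φ q).toMonoidHom) (hφπ q) A)
    (isEquivariant_over (φ := (φ (p * q)).toMonoidHom) (hφπ (p * q)) A) h rfl n x).symm

theorem twist_bijective (A : Rep.{u} k Q) (n : ℕ) (m : ℕ+) :
    Function.Bijective (twist hφπ A n m) := by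
  have hinv : ∀ x, π ((φ m).symm x) = π x := fun x => by
    rw [← hφπ m, MulEquiv.apply_symm_apply]
  have h := isEquivariant_over (k := k) (φ := (φ m).symm.toMonoidHom) hinv A
  refine Function.bijective_iff_has_inverse.2 ⟨hmap h n, fun x => ?_, fun x => ?_⟩
  · exact hmap_hmap_eq_self h (isEquivariant_over (φ := (φ m).toMonoidHom) (hφπ m) A)
      (MonoidHom.ext (φ m).symm_apply_apply) rfl n x
  · exact hmap_hmap_eq_self (isEquivariant_over (φ := (φ m).toMonoidHom) (hφπ m) A) h
      (MonoidHom.ext (φ m).apply_symm_apply) rfl n x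

include hs in
/-- On the homology of `E` with coefficients `k[Q] ⊗ B`, which is that of the kernel, `φ m` has the
generalized eigenvalue `m ^ n`. -/
theorem twist_free_sub_bijective (hφN : ∀ m, ∀ x ∈ π.ker, φ m x = x ^ (m : ℕ))
    (hN : HasPowWeight k π.ker) (B : Type u) [AddCommGroup B] [Module k B] (n : ℕ) {p q : ℕ+}
    (hpq : p ≠ q) :
    Function.Bijective (twist hφπ (freeRep k Q B) (n + 1) p -
      twist hφπ (freeRep k Q B) (n + 1) q) := by
  refine bijective_sub_of_maxGenEigenspace n.succ_ne_zero (twist_bijective hφπ _ _)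
    (fun p q => ?_) (fun m x => ?_) hpq
  · rw [commute_iff_eq, ← twist_mul, ← twist_mul, mul_comm]
  · have hπ : Function.Surjective π := fun q => ⟨s q, hs q⟩
    let A := Rep.trivial k E B
    have hι : IsEquivariant (Rep.res π.ker.subtype A) (Rep.res π (freeRep k Q B)) π.ker.subtype
        (Finsupp.lsingle 1) := single_one_isEquivariant π A
    have hsurj : Function.Surjective (hmap hι (n + 1)) :=
      hmap_single_one_surjective π hπ (n + 1) A
    obtain ⟨y, rfl⟩ := hsurj x
    let ψ : π.ker →* π.ker := ((φ m).toMonoidHom.comp π.ker.subtype).codRestrict π.ker fun x =>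
      (hφπ m x).trans x.2
    have hψ : ∀ x, ψ x = x ^ (m : ℕ) := fun x => Subtype.ext (hφN m x x.2)
    have hψA : IsEquivariant (Rep.res π.ker.subtype A) (Rep.res π.ker.subtype A) ψ
      LinearMap.id := fun g x => rfl
    exact map_mem_maxGenEigenspace (hmap_hmap_eq hι hψA
      (isEquivariant_over (φ := (φ m).toMonoidHom) (hφπ m) (freeRep k Q B)) hι rfl rfl (n + 1))
      (hN _ (fun _ _ => rfl) (n + 1) m ψ hψ hψA y)

theorem hmap_inflate_twist_sub (A : Rep.{u} k Q) (n : ℕ) (p q : ℕ+)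
    (x : groupHomology (Rep.res π A) n) :
    hmap (isEquivariant_inflate π A) n ((twist hφπ A n p - twist hφπ A n q) x) = 0 := by
  have h : ∀ m, hmap (isEquivariant_inflate π A) n (twist hφπ A n m x) =
      hmap (isEquivariant_inflate π A) n x := fun m =>
    hmap_hmap_eq_hmap (isEquivariant_inflate π A)
      (isEquivariant_over (φ := (φ m).toMonoidHom) (hφπ m) A) (isEquivariant_inflate π A)
      (MonoidHom.ext (hφπ m)) rfl n x
  rw [LinearMap.sub_apply, map_sub, h, h, sub_self]

theorem hmap_inflate_section (A : Rep.{u} k Q) (n : ℕ) (x : groupHomology A n) :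
    hmap (isEquivariant_inflate π A) n (hmap (isEquivariant_section hs A) n x) = x :=
  hmap_hmap_eq_self (isEquivariant_inflate π A) (isEquivariant_section hs A) (MonoidHom.ext hs) rfl
    n x

include hs in
/-- On the kernel of `H_n(E, A) → H_n(Q, A)`, the difference of the actions of `φ p` and `φ q` is
bijective. The proof shifts dimensions along the free cover of the `Q`-module `A`, by a four lemma
argument on these kernels, which form a long exact sequence because `E → Q` splits. Injectivity in
degree `n + 1` uses surjectivity in the same degree for the syzygy, so both are proved for all
coefficients at once. -/
theorem twist_sub_bijective (hφN : ∀ m, ∀ x ∈ π.ker, φ m x = x ^ (m : ℕ))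
    (hN : HasPowWeight k π.ker) {p q : ℕ+} (hpq : p ≠ q) (n : ℕ) :
    (∀ A : Rep.{u} k Q, ∀ x, hmap (isEquivariant_inflate π A) n x = 0 →
      (twist hφπ A n p - twist hφπ A n q) x = 0 → x = 0) ∧
    (∀ A : Rep.{u} k Q, ∀ x, hmap (isEquivariant_inflate π A) n x = 0 →
      ∃ y, hmap (isEquivariant_inflate π A) n y = 0 ∧
        (twist hφπ A n p - twist hφπ A n q) y = x) := by
  have hπ : Function.Surjective π := fun q => ⟨s q, hs q⟩
  induction n with
  | zero =>
    have h0 : ∀ A : Rep.{u} k Q, ∀ x, hmap (isEquivariant_inflate π A) 0 x = 0 → x = 0 :=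
      fun A x hx => hmap_inflate_zero_injective hπ A (hx.trans (map_zero _).symm)
    exact ⟨fun A x hx _ => h0 A x hx,
      fun A x hx => ⟨0, map_zero _, by rw [map_zero, h0 A x hx]⟩⟩
  | succ n ih =>
    obtain ⟨ihi, ihs⟩ := ih
    let D : ∀ (A : Rep.{u} k Q) (n : ℕ), Module.End k (groupHomology (Rep.res π A) n) :=
      fun A n => twist hφπ A n p - twist hφπ A n q
    -- compatibility of the structure maps with a short exact sequence of coefficients
    have Dinc : ∀ {A B C : Rep.{u} k Q} (S : ShortSeq A B C) n x,
        D B n (hmap (S.res π).inc_equi n x) = hmap (S.res π).inc_equi n (D A n x) := by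
      intro A B C S n x
      have h : ∀ m, twist hφπ B n m (hmap (S.res π).inc_equi n x) =
          hmap (S.res π).inc_equi n (twist hφπ A n m x) := fun m =>
        hmap_hmap_eq (isEquivariant_over (φ := (φ m).toMonoidHom) (hφπ m) B) (S.res π).inc_equi
          (S.res π).inc_equi (isEquivariant_over (φ := (φ m).toMonoidHom) (hφπ m) A) rfl rfl n x
      simp only [D, LinearMap.sub_apply, map_sub, h]
    have Dproj : ∀ {A B C : Rep.{u} k Q} (S : ShortSeq A B C) n x,
        D C n (hmap (S.res π).proj_equi n x) = hmap (S.res π).proj_equi n (D B n x) := by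
      intro A B C S n x
      have h : ∀ m, twist hφπ C n m (hmap (S.res π).proj_equi n x) =
          hmap (S.res π).proj_equi n (twist hφπ B n m x) := fun m =>
        hmap_hmap_eq (isEquivariant_over (φ := (φ m).toMonoidHom) (hφπ m) C) (S.res π).proj_equi
          (S.res π).proj_equi (isEquivariant_over (φ := (φ m).toMonoidHom) (hφπ m) B) rfl rfl n x
      simp only [D, LinearMap.sub_apply, map_sub, h]
    have Dδ : ∀ {A B C : Rep.{u} k Q} (S : ShortSeq A B C) n x,
        D A n ((S.res π).δ n x) = (S.res π).δ n (D C (n + 1) x) := by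
      intro A B C S n x
      have h : ∀ m, twist hφπ A n m ((S.res π).δ n x) =
          (S.res π).δ n (twist hφπ C (n + 1) m x) := fun m =>
        (S.res π).δ_naturality (S.res π) (isEquivariant_over (φ := (φ m).toMonoidHom) (hφπ m) A)
          (isEquivariant_over (φ := (φ m).toMonoidHom) (hφπ m) B)
          (isEquivariant_over (φ := (φ m).toMonoidHom) (hφπ m) C) rfl rfl n x
      simp only [D, LinearMap.sub_apply, map_sub, h]
    have iδ : ∀ {A B C : Rep.{u} k Q} (S : ShortSeq A B C) n x,
        hmap (isEquivariant_inflate π A) n ((S.res π).δ n x) =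
          S.δ n (hmap (isEquivariant_inflate π C) (n + 1) x) := fun {A B C} S n x =>
      (S.res π).δ_naturality S (isEquivariant_inflate π A)
        (isEquivariant_inflate π B) (isEquivariant_inflate π C) rfl rfl n x
    have sδ : ∀ {A B C : Rep.{u} k Q} (S : ShortSeq A B C) n x,
        hmap (isEquivariant_section hs A) n (S.δ n x) =
          (S.res π).δ n (hmap (isEquivariant_section hs C) (n + 1) x) := fun {A B C} S n x =>
      S.δ_naturality (S.res π) (isEquivariant_section hs A)
        (isEquivariant_section hs B) (isEquivariant_section hs C) rfl rfl n x
    have iinc : ∀ {A B C : Rep.{u} k Q} (S : ShortSeq A B C) n x,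
        hmap (isEquivariant_inflate π B) n (hmap (S.res π).inc_equi n x) =
          hmap S.inc_equi n (hmap (isEquivariant_inflate π A) n x) := fun {A B C} S n x =>
      hmap_hmap_eq (isEquivariant_inflate π B) (S.res π).inc_equi S.inc_equi
        (isEquivariant_inflate π A) rfl rfl n x
    have sinc : ∀ {A B C : Rep.{u} k Q} (S : ShortSeq A B C) n x,
        hmap (isEquivariant_section hs B) n (hmap S.inc_equi n x) =
          hmap (S.res π).inc_equi n (hmap (isEquivariant_section hs A) n x) := fun {A B C} S n x =>
      hmap_hmap_eq (isEquivariant_section hs B) S.inc_equi (S.res π).inc_equi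
        (isEquivariant_section hs A) rfl rfl n x
    have iproj : ∀ {A B C : Rep.{u} k Q} (S : ShortSeq A B C) n x,
        hmap (isEquivariant_inflate π C) n (hmap (S.res π).proj_equi n x) =
          hmap S.proj_equi n (hmap (isEquivariant_inflate π B) n x) := fun {A B C} S n x =>
      hmap_hmap_eq (isEquivariant_inflate π C) (S.res π).proj_equi S.proj_equi
        (isEquivariant_inflate π B) rfl rfl n x
    have base : ∀ A : Rep.{u} k Q, Function.Bijective (D (freeRep k Q A.V) (n + 1)) := fun A =>
      twist_free_sub_bijective hs hφπ hφN hN A.V n hpq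
    have surj : ∀ A : Rep.{u} k Q, ∀ x, hmap (isEquivariant_inflate π A) (n + 1) x = 0 →
        ∃ y, hmap (isEquivariant_inflate π A) (n + 1) y = 0 ∧ D A (n + 1) y = x := by
      intro A x hx
      let S := coverSeq A
      obtain ⟨y, hy, hDy⟩ := ihs _ ((S.res π).δ n x) (by rw [iδ, hx, map_zero])
      have h1 : hmap (S.res π).inc_equi n y = 0 := by
        refine ihi _ _ (by rw [iinc, hy, map_zero]) ((Dinc S n y).trans ?_)
        exact (congrArg _ hDy).trans (((S.res π).exact_δ_inc n).apply_apply_eq_zero x)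
      obtain ⟨z, rfl⟩ := ((S.res π).exact_δ_inc n y).1 h1
      -- correct `z` so that it maps to zero in the homology of `Q`
      let z' := z - hmap (isEquivariant_section hs A) (n + 1)
        (hmap (isEquivariant_inflate π A) (n + 1) z)
      have hz' : hmap (isEquivariant_inflate π A) (n + 1) z' = 0 := by
        rw [map_sub, hmap_inflate_section hs, sub_self]
      have hδz' : (S.res π).δ n z' = (S.res π).δ n z := by
        rw [map_sub, ← sδ, ← iδ, hy, map_zero, sub_zero]
      have h2 : (S.res π).δ n (x - D A (n + 1) z') = 0 := by
        rw [map_sub, ← Dδ, hδz', sub_eq_zero]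
        exact hDy.symm
      obtain ⟨w, hw⟩ := ((S.res π).exact_proj_δ n _).1 h2
      obtain ⟨w', rfl⟩ := (base A).2 w
      refine ⟨z' + hmap (S.res π).proj_equi (n + 1) w', ?_, ?_⟩
      · rw [map_add, hz', iproj, homology_succ_free_eq_zero A.V n
          (hmap (isEquivariant_inflate π (freeRep k Q A.V)) (n + 1) w'), map_zero, add_zero]
      · rw [map_add, Dproj, hw, add_sub_cancel]
    refine ⟨fun A x hx hDx => ?_, surj⟩
    let S := coverSeq A
    have h1 : (S.res π).δ n x = 0 := by
      refine ihi _ _ (by rw [iδ, hx, map_zero]) ((Dδ S n x).trans ?_)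
      exact (congrArg _ hDx).trans (map_zero _)
    obtain ⟨w, rfl⟩ := ((S.res π).exact_proj_δ n x).1 h1
    have h2 : hmap (S.res π).proj_equi (n + 1) (D _ (n + 1) w) = 0 := (Dproj S _ w).symm.trans hDx
    obtain ⟨t, ht⟩ := ((S.res π).exact_inc_proj (n + 1) _).1 h2
    -- correct `t` in the same way
    let t' := t - hmap (isEquivariant_section hs (syzygy A)) (n + 1)
      (hmap (isEquivariant_inflate π (syzygy A)) (n + 1) t)
    have ht' : hmap (isEquivariant_inflate π (syzygy A)) (n + 1) t' = 0 := by
      rw [map_sub, hmap_inflate_section hs, sub_self]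
    have hinct' : hmap (S.res π).inc_equi (n + 1) t' = D _ (n + 1) w := by
      rw [map_sub, ← sinc, ← iinc, ht]
      have := hmap_inflate_twist_sub hφπ (freeRep k Q A.V) (n + 1) p q w
      rw [this, map_zero, sub_zero]
    obtain ⟨t'', -, ht''⟩ := surj _ t' ht'
    have h3 : w = hmap (S.res π).inc_equi (n + 1) t'' := by
      refine (base A).1 ?_
      rw [Dinc, ht'', hinct']
    rw [h3]
    exact ((S.res π).exact_inc_proj (n + 1)).apply_apply_eq_zero t''

end Split

/-! ### Splitting off the additive part of a module -/

section ModuleDecomposition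

variable {F : Type u} [Field F] [CharZero F] {H : Type u} [AddCommGroup H]
  [Module (MonoidAlgebra ℤ Fˣ) H]

theorem bijective_smul_of_dvd {R T : Type*} [CommRing R] [AddCommGroup T] [Module R T] {r t : R}
    (h : r ∣ t) (ht : Function.Bijective fun x : T => t • x) :
    Function.Bijective fun x : T => r • x := by
  obtain ⟨c, rfl⟩ := h
  refine ⟨fun x y hxy => ht.1 ?_, fun x => ?_⟩
  · simp only [mul_comm r c, mul_smul] at hxy ⊢
    rw [hxy]
  · obtain ⟨y, hy⟩ := ht.2 x
    exact ⟨c • y, by simpa only [mul_smul] using hy⟩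

theorem bijective_smul_ker {R T T' : Type*} [CommRing R] [AddCommGroup T] [Module R T]
    [AddCommGroup T'] [Module R T'] (P : T →ₗ[R] T') (t : R)
    (hinj : ∀ x, P x = 0 → t • x = 0 → x = 0) (hsurj : ∀ x, P x = 0 → ∃ y, P y = 0 ∧ t • y = x) :
    Function.Bijective fun x : LinearMap.ker P => t • x := by
  constructor
  · intro x y hxy
    rw [← sub_eq_zero]
    refine Subtype.ext (hinj _ (x - y).2 ?_)
    have := congrArg Subtype.val (sub_eq_zero.2 hxy)
    rwa [← smul_sub] at this
  · intro x
    obtain ⟨y, hy, hyx⟩ := hsurj x.1 x.2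
    exact ⟨⟨y, hy⟩, Subtype.ext hyx⟩

/-- It suffices to test additivity on the generators of `rationalSet`. -/
theorem isAdditive_of_generators
    (h : ∀ a : ℚˣ, a ≠ 1 → a ≠ -1 → Function.Bijective fun x : H =>
      (MonoidAlgebra.of ℤ Fˣ (Units.map (Rat.castHom F).toMonoidHom a) - 1) • x) :
    IsAdditive F H := by
  intro s hs
  induction hs using Submonoid.closure_induction with
  | mem s hs =>
    obtain ⟨a, h1, h2, rfl⟩ := hs
    exact h a h1 h2
  | one => simpa only [one_smul] using! Function.bijective_id
  | mul s t _ _ hs ht => simpa only [mul_smul] using! hs.comp ht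

variable {C D : Submodule (MonoidAlgebra ℤ Fˣ) H}

theorem additivePart_eq (hCD : IsCompl C D) (hC : IsAdditive F C) (hD : IsMultiplicative F D) :
    additivePart F H = C := by
  refine le_antisymm (sSup_le fun N hN => ?_) (le_sSup hC)
  obtain ⟨s, hs, hsD⟩ := hD
  intro x hx
  -- `x = s y`, and `s` kills the component of `y` in `D`
  obtain ⟨y, hy⟩ := (hN s hs).2 ⟨x, hx⟩
  have hxy : s • (y : H) = x := congrArg Subtype.val hy
  obtain ⟨c, hc, d, hd, hcd⟩ := Submodule.mem_sup.1
    (hCD.sup_eq_top ▸ Submodule.mem_top : (y : H) ∈ C ⊔ D)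
  have h0 : s • d = 0 := congrArg Subtype.val (hsD ⟨d, hd⟩)
  rw [← hxy, ← hcd, smul_add, h0, add_zero]
  exact C.smul_mem s hc

theorem multiplicativePart_eq (hCD : IsCompl C D) (hC : IsAdditive F C)
    (hD : IsMultiplicative F D) : multiplicativePart F H = D := by
  refine le_antisymm (sSup_le fun N hN => ?_) (le_sSup hD)
  obtain ⟨s, hs, hsN⟩ := hN
  intro x hx
  obtain ⟨c, hc, d, hd, hcd⟩ := Submodule.mem_sup.1
    (hCD.sup_eq_top ▸ Submodule.mem_top : x ∈ C ⊔ D)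
  have h0 : s • x = 0 := congrArg Subtype.val (hsN ⟨x, hx⟩)
  rw [← hcd, smul_add] at h0
  -- `s c = - s d` lies in both `C` and `D`
  have h1 : s • c = 0 := by
    refine (Submodule.disjoint_def.1 hCD.disjoint) _ (C.smul_mem s hc) ?_
    rw [eq_neg_of_add_eq_zero_left h0]
    exact D.neg_mem (D.smul_mem s hd)
  have h2 : (⟨c, hc⟩ : C) = 0 := (hC s hs).1 (by
    change s • (⟨c, hc⟩ : C) = s • 0
    rw [smul_zero]
    exact Subtype.ext h1)
  have h3 : c = 0 := congrArg Subtype.val h2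
  rw [← hcd, h3, zero_add]
  exact hd

theorem isAM_of_isCompl (hCD : IsCompl C D) (hC : IsAdditive F C) (hD : IsMultiplicative F D) :
    IsAM F H :=
  ⟨C, D, inferInstance, inferInstance, inferInstance, inferInstance, hC, hD,
    ⟨(Submodule.prodEquivOfIsCompl C D hCD).symm⟩⟩

end ModuleDecomposition

/-! ### Integral homology and its conjugation action -/

section Descent

variable {E Q : Type u} [Group E] [Group Q] {π : E →* Q} {s : Q →* E}

/-- Let `E → Q` be a split extension with kernel `N`, and let `φ` be an action on `E` over `Q` for
which `φ m` is the `m`-th power map on `N`. On the kernel of `H_n(E, ℤ) → H_n(Q, ℤ)`, the difference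
of the maps induced by `φ p` and `φ q` is bijective. -/
theorem homologyMap_sub_bijective (hs : ∀ q, π (s q) = q) {φ : ℕ+ →* MulAut E}
    (hφπ : ∀ m x, π (φ m x) = π x)
    (hφN : ∀ m, ∀ x ∈ π.ker, φ m x = x ^ (m : ℕ)) (hN : HasPowWeight (ULift.{u} ℤ) π.ker)
    {p q : ℕ+} (hpq : p ≠ q) (n : ℕ) :
    (∀ x, homologyMap n π x = 0 →
      homologyMap n (φ p).toMonoidHom x - homologyMap n (φ q).toMonoidHom x = 0 → x = 0) ∧
    (∀ x, homologyMap n π x = 0 → ∃ y, homologyMap n π y = 0 ∧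
      homologyMap n (φ p).toMonoidHom y - homologyMap n (φ q).toMonoidHom y = x) :=
  have h := twist_sub_bijective hs hφπ hφN hN hpq n
  ⟨h.1 (trivialZ Q), h.2 (trivialZ Q)⟩

variable {G G' D : Type u} [Group G] [Group G'] [Group D] {φ : G →* D} {φ' : G' →* D} (n : ℕ)

/-- The `ℤ[D]`-linear map on homology induced by a homomorphism `ker φ → ker φ'`, if for each `d`
the homomorphism intertwines conjugation by some elements of `G` and `G'` above `d`. -/
def homologyLinearMap (hφ : Function.Surjective φ) (hφ' : Function.Surjective φ')
    (f : φ.ker →* φ'.ker)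
    (hf : ∀ d, ∃ g g', φ g = d ∧ φ' g' = d ∧ ∀ x,
      f (MulAut.conjNormal g x) = MulAut.conjNormal g' (f x)) :
    (quotientAction n hφ).asModule →ₗ[MonoidAlgebra ℤ D] (quotientAction n hφ').asModule :=
  Representation.IntertwiningMap.equivLinearMapAsModule _ _
    { (homologyMap n f).toIntLinearMap with
      isIntertwining' := fun d => by
        obtain ⟨g, g', rfl, hg', h⟩ := hf d
        have h1 : quotientAction n hφ' (φ g) = conjAction n φ' g' := by
          rw [← hg', quotientAction_apply]
        rw [h1, quotientAction_apply]
        have h2 : f.comp (MulAut.conjNormal (H := φ.ker) g).toMonoidHom =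
            (MulAut.conjNormal (H := φ'.ker) g').toMonoidHom.comp f := MonoidHom.ext h
        have h3 := homologyMap_comp n f (MulAut.conjNormal (H := φ.ker) g).toMonoidHom
        rw [h2, homologyMap_comp] at h3
        ext x
        exact (DFunLike.congr_fun h3 x).symm }

/-- The basis element `⟨φ g⟩` acts on homology by conjugation with `g`. -/
theorem of_smul_eq (hφ : Function.Surjective φ) (g : G) (x : (quotientAction n hφ).asModule) :
    MonoidAlgebra.of ℤ D (φ g) • x =
      homologyMap n (MulAut.conjNormal (H := φ.ker) g).toMonoidHom x := by
  have h1 := Representation.asModuleEquiv_symm_map_rho (quotientAction n hφ) (φ g)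
    ((quotientAction n hφ).asModuleEquiv x)
  rw [LinearEquiv.symm_apply_apply, quotientAction_apply] at h1
  exact h1.symm

end Descent

/-! ### Block-triangular groups -/

section BlockGroups

variable {F : Type u} [Field F] {W V : Type u} [AddCommGroup W] [Module F W] [AddCommGroup V]
  [Module F V] {G₁ : Subgroup (LinearMap.GeneralLinearGroup F W)}
  {G₂ : Subgroup (LinearMap.GeneralLinearGroup F V)} {M : Submodule F (V →ₗ[F] W)}
  {h₁ : ∀ g ∈ G₁, ∀ f ∈ M, g.val ∘ₗ f ∈ M} {h₂ : ∀ g ∈ G₂, ∀ f ∈ M, f ∘ₗ g.val ∈ M}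

/-- The block-diagonal part of an endomorphism of `W ⊕ V`. -/
def diagonalPart (g : W × V →ₗ[F] W × V) : W × V →ₗ[F] W × V :=
  blockMap (LinearMap.fst F W V ∘ₗ g ∘ₗ LinearMap.inl F W V) 0
    (LinearMap.snd F W V ∘ₗ g ∘ₗ LinearMap.inr F W V)

theorem diagonalPart_blockMap (a : W →ₗ[F] W) (f : V →ₗ[F] W) (b : V →ₗ[F] V) :
    diagonalPart (blockMap a f b) = blockMap a 0 b := by
  refine LinearMap.ext fun x => ?_
  simp [diagonalPart]

theorem blockMap_injective {a a' : W →ₗ[F] W} {f f' : V →ₗ[F] W} {b b' : V →ₗ[F] V}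
    (h : blockMap a f b = blockMap a' f' b') : a = a' ∧ f = f' ∧ b = b' := by
  refine ⟨?_, ?_, ?_⟩ <;> ext x
  · simpa using congrArg Prod.fst (LinearMap.congr_fun h (x, 0))
  · simpa using congrArg Prod.fst (LinearMap.congr_fun h (0, x))
  · simpa using congrArg Prod.snd (LinearMap.congr_fun h (0, x))

/-- The projection of the block-triangular group onto the block-diagonal group. -/
def blockProj : blockTriangular G₁ G₂ M h₁ h₂ →* blockDiagonal G₁ G₂ :=
  (MonoidHom.toHomUnits
    { toFun := fun g : blockTriangular G₁ G₂ M h₁ h₂ => diagonalPart g.1.val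
      map_one' := by
        change diagonalPart (1 : W × V →ₗ[F] W × V) = 1
        rw [← blockMap_one, diagonalPart_blockMap]
      map_mul' := by
        rintro ⟨g, a, ha, f, hf, b, hb, hg⟩ ⟨g', a', ha', f', hf', b', hb', hg'⟩
        change diagonalPart (g.val * g'.val) = diagonalPart g.val * diagonalPart g'.val
        rw [hg, hg', blockMap_mul, diagonalPart_blockMap, diagonalPart_blockMap,
          diagonalPart_blockMap, blockMap_mul]
        simp }).codRestrict (blockDiagonal G₁ G₂) (by
    rintro ⟨g, a, ha, f, hf, b, hb, hg⟩
    refine ⟨(a, b), ⟨ha, hb⟩, Units.ext ?_⟩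
    change _ = diagonalPart g.val
    rw [val_blockDiagonalHom, hg, diagonalPart_blockMap])

theorem val_blockProj (g : blockTriangular G₁ G₂ M h₁ h₂) :
    (blockProj g).1.val = diagonalPart g.1.val := rfl

theorem blockProj_inclusion (g : blockDiagonal G₁ G₂) :
    blockProj (Subgroup.inclusion (blockDiagonal_le h₁ h₂) g) = g := by
  obtain ⟨_, ⟨a, b⟩, hab, rfl⟩ := g
  refine Subtype.ext (Units.ext ?_)
  rw [val_blockProj]
  change diagonalPart (blockDiagonalHom (a, b)).val = (blockDiagonalHom (a, b)).val
  rw [val_blockDiagonalHom, diagonalPart_blockMap]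

theorem exists_eq_blockMap_one {g : blockTriangular G₁ G₂ M h₁ h₂} (hg : blockProj g = 1) :
    ∃ f, g.1.val = blockMap 1 f 1 := by
  obtain ⟨g, a, ha, f, hf, b, hb, h⟩ := g
  have h1 : diagonalPart g.val = 1 := congrArg (fun t => t.1.val) hg
  rw [h, diagonalPart_blockMap, ← blockMap_one] at h1
  obtain ⟨ha1, -, hb1⟩ := blockMap_injective h1
  exact ⟨f, by rw [h, ha1, hb1]⟩

theorem blockMap_one_mul (f f' : V →ₗ[F] W) :
    blockMap (1 : W →ₗ[F] W) f (1 : V →ₗ[F] V) * blockMap 1 f' 1 = blockMap 1 (f + f') 1 := by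
  rw [blockMap_mul, mul_one, mul_one, add_comm]
  rfl

theorem blockMap_one_pow (f : V →ₗ[F] W) (n : ℕ) :
    blockMap (1 : W →ₗ[F] W) f (1 : V →ₗ[F] V) ^ n = blockMap 1 (n • f) 1 := by
  induction n with
  | zero => rw [pow_zero, zero_smul, blockMap_one]
  | succ n ih => rw [pow_succ, ih, blockMap_one_mul, succ_nsmul]

/-- The scalar `a` on `V` and the identity on `W`, as an element of `G₁ × G₂`. -/
def scalarElement
    (hscalar : ∀ a : Fˣ, Units.map (algebraMap F (Module.End F V)).toMonoidHom a ∈ G₂) :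
    Fˣ →* blockDiagonal G₁ G₂ :=
  (blockDiagonalHom.comp
    ((1 : Fˣ →* LinearMap.GeneralLinearGroup F W).prod
      (Units.map (algebraMap F (Module.End F V)).toMonoidHom))).codRestrict _ fun a =>
        ⟨_, ⟨one_mem _, hscalar a⟩, rfl⟩

variable (hscalar : ∀ a : Fˣ, Units.map (algebraMap F (Module.End F V)).toMonoidHom a ∈ G₂)

theorem val_scalarElement (a : Fˣ) :
    (scalarElement (G₁ := G₁) hscalar a).1.val =
      blockMap (1 : W →ₗ[F] W) 0 (algebraMap F (Module.End F V) a) :=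
  val_blockDiagonalHom _ _

theorem scalarElement_mul_comm (a : Fˣ) (g : blockDiagonal G₁ G₂) :
    scalarElement hscalar a * g = g * scalarElement hscalar a := by
  obtain ⟨_, ⟨c, d⟩, hcd, rfl⟩ := g
  refine Subtype.ext (Units.ext ?_)
  change (scalarElement (G₁ := G₁) hscalar a).1.val * (blockDiagonalHom (c, d)).val =
    (blockDiagonalHom (c, d)).val * (scalarElement (G₁ := G₁) hscalar a).1.val
  rw [val_scalarElement, val_blockDiagonalHom, blockMap_mul, blockMap_mul, one_mul, mul_one,
    Algebra.commutes]
  simp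

/-- The scalar `a` on `V` has determinant `a ^ dim V` on `W ⊕ V`. -/
theorem detOn_scalarElement [FiniteDimensional F W] [FiniteDimensional F V] (a : Fˣ) :
    detOn (blockDiagonal G₁ G₂) (scalarElement hscalar a) = a ^ Module.finrank F V := by
  ext
  change LinearMap.det (scalarElement (G₁ := G₁) hscalar a).1.val = _
  rw [val_scalarElement, det_blockMap, map_one, one_mul, Algebra.algebraMap_eq_smul_one,
    LinearMap.det_smul, map_one, mul_one, Units.val_pow_eq_pow_val]

theorem detOn_blockProj [FiniteDimensional F W] [FiniteDimensional F V]
    (g : blockTriangular G₁ G₂ M h₁ h₂) :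
    detOn (blockDiagonal G₁ G₂) (blockProj g) = detOn (blockTriangular G₁ G₂ M h₁ h₂) g := by
  obtain ⟨g, a, ha, f, hf, b, hb, hg⟩ := g
  ext
  change LinearMap.det (diagonalPart g.val) = LinearMap.det g.val
  rw [hg, diagonalPart_blockMap, det_blockMap, det_blockMap]

section Special

theorem specialInclusion_conj (g : blockDiagonal G₁ G₂) (x : special (blockDiagonal G₁ G₂)) :
    specialInclusion (blockDiagonal_le h₁ h₂) (MulAut.conjNormal g x) =
      MulAut.conjNormal (Subgroup.inclusion (blockDiagonal_le h₁ h₂) g)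
        (specialInclusion (blockDiagonal_le h₁ h₂) x) := by
  refine Subtype.ext ?_
  rw [MulAut.conjNormal_apply]
  change Subgroup.inclusion (blockDiagonal_le h₁ h₂) (MulAut.conjNormal g x).1 = _
  rw [MulAut.conjNormal_apply]
  rfl

theorem conjNormal_scalarElement (a : Fˣ) (x : special (blockDiagonal G₁ G₂)) :
    MulAut.conjNormal (scalarElement hscalar a) x = x := by
  refine Subtype.ext ?_
  rw [MulAut.conjNormal_apply, scalarElement_mul_comm, mul_inv_cancel_right]

variable [FiniteDimensional F W] [FiniteDimensional F V]

/-- The projection `SG → S(G₁ × G₂)`. -/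
def specialProj : special (blockTriangular G₁ G₂ M h₁ h₂) →* special (blockDiagonal G₁ G₂) :=
  (blockProj.comp (special (blockTriangular G₁ G₂ M h₁ h₂)).subtype).codRestrict
    (special (blockDiagonal G₁ G₂)) fun x => by
      rw [MonoidHom.mem_ker]
      exact (detOn_blockProj x.1).trans (MonoidHom.mem_ker.1 x.2)

theorem specialProj_inclusion (x : special (blockDiagonal G₁ G₂)) :
    specialProj (specialInclusion (blockDiagonal_le h₁ h₂) x) = x :=
  Subtype.ext (blockProj_inclusion x.1)

theorem specialProj_conj (g : blockTriangular G₁ G₂ M h₁ h₂)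
    (x : special (blockTriangular G₁ G₂ M h₁ h₂)) :
    specialProj (MulAut.conjNormal g x) = MulAut.conjNormal (blockProj g) (specialProj x) := by
  refine Subtype.ext ?_
  rw [MulAut.conjNormal_apply]
  change blockProj (MulAut.conjNormal g x).1 = blockProj g * blockProj x.1 * (blockProj g)⁻¹
  rw [MulAut.conjNormal_apply, map_mul, map_mul, map_inv]

/-- An element of the kernel of `SG → S(G₁ × G₂)` is a block-unipotent matrix. -/
theorem exists_eq_of_mem_ker {x : special (blockTriangular G₁ G₂ M h₁ h₂)}
    (hx : x ∈ specialProj.ker) : ∃ f, x.1.1.val = blockMap 1 f 1 :=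
  exists_eq_blockMap_one (congrArg Subtype.val hx)

/-- The kernel of `SG → S(G₁ × G₂)` is torsion-free abelian, being isomorphic to a subgroup of the
`F`-vector space `Hom(V, W)`. -/
theorem hasPowWeight_ker_specialProj [CharZero F] (k : Type u) [CommRing k] :
    HasPowWeight k (specialProj (h₁ := h₁) (h₂ := h₂)).ker := by
  let N := (specialProj (h₁ := h₁) (h₂ := h₂)).ker
  have hval : Function.Injective fun x : N => x.1.1.1.val := fun x y h =>
    Subtype.ext (Subtype.ext (Subtype.ext (Units.ext h)))
  let : CommGroup N :=
    { (inferInstance : Group N) with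
      mul_comm := fun x y => by
        obtain ⟨f, hf⟩ := exists_eq_of_mem_ker x.2
        obtain ⟨f', hf'⟩ := exists_eq_of_mem_ker y.2
        refine hval ?_
        change x.1.1.1.val * y.1.1.1.val = y.1.1.1.val * x.1.1.1.val
        rw [hf, hf', blockMap_one_mul, blockMap_one_mul, add_comm] }
  have : IsMulTorsionFree N := ⟨fun n hn x y h => by
    obtain ⟨f, hf⟩ := exists_eq_of_mem_ker x.2
    obtain ⟨f', hf'⟩ := exists_eq_of_mem_ker y.2
    have h1 : x.1.1.1.val ^ n = y.1.1.1.val ^ n := congrArg (fun x : N => x.1.1.1.val) h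
    rw [hf, hf', blockMap_one_pow, blockMap_one_pow] at h1
    obtain ⟨-, h2, -⟩ := blockMap_injective h1
    have h3 : (n : F) • f = (n : F) • f' := by simpa only [Nat.cast_smul_eq_nsmul] using h2
    have h4 : f = f' := smul_right_injective _ (Nat.cast_ne_zero.2 hn) h3
    refine hval ?_
    change x.1.1.1.val = y.1.1.1.val
    rw [hf, hf', h4]⟩
  exact hasPowWeight_of_torsionFree N

/-- The positive integers, as units of a field of characteristic zero. -/
def natUnit (F : Type u) [Field F] [CharZero F] : ℕ+ →* Fˣ where
  toFun m := Units.mk0 ((m : ℕ) : F) (Nat.cast_ne_zero.2 m.ne_zero)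
  map_one' := by ext; simp
  map_mul' p q := by ext; simp

/-- Conjugation on `SG` by the scalar `m⁻¹` on `V`. -/
def scalarConj [CharZero F] :
    ℕ+ →* MulAut (special (blockTriangular G₁ G₂ M h₁ h₂)) :=
  (MulAut.conjNormal.comp ((Subgroup.inclusion (blockDiagonal_le h₁ h₂)).comp
    (scalarElement hscalar))).comp (invMonoidHom.comp (natUnit F))

theorem specialProj_scalarConj [CharZero F] (m : ℕ+)
    (x : special (blockTriangular G₁ G₂ M h₁ h₂)) :
    specialProj (scalarConj hscalar m x) = specialProj x := by
  refine (specialProj_conj _ x).trans ?_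
  simp only [MonoidHom.comp_apply, blockProj_inclusion]
  exact conjNormal_scalarElement hscalar _ _

/-- The conjugation is by `m⁻¹`, so that it is the `m`-th power map on the unipotent part. -/
theorem scalarConj_ker [CharZero F] (m : ℕ+)
    (x : special (blockTriangular G₁ G₂ M h₁ h₂)) (hx : x ∈ specialProj.ker) :
    scalarConj hscalar m x = x ^ (m : ℕ) := by
  obtain ⟨f, hf⟩ := exists_eq_of_mem_ker hx
  let c := scalarElement (G₁ := G₁) hscalar (natUnit F m)⁻¹
  have hc : c.1⁻¹ = (scalarElement (G₁ := G₁) hscalar (natUnit F m)).1 := by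
    simp only [c, map_inv]
    rw [Subgroup.coe_inv, inv_inv]
  refine Subtype.ext (Subtype.ext (Units.ext ?_))
  have h1 : ((scalarConj hscalar m x).1.1).val = c.1.val * x.1.1.val * (c.1⁻¹).val := rfl
  have h2 : ((x ^ (m : ℕ)).1.1).val = x.1.1.val ^ (m : ℕ) := rfl
  refine h1.trans (Eq.trans ?_ h2.symm)
  rw [hc, hf, blockMap_one_pow, val_scalarElement, val_scalarElement, blockMap_mul, blockMap_mul,
    mul_one ((algebraMap F (Module.End F V)) _), ← map_mul, Units.inv_mul, map_one]
  congr 1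
  ext v
  simp [natUnit]

variable (hdet : Function.Surjective (detOn (blockTriangular G₁ G₂ M h₁ h₂))) (i : ℕ)

/-- The map `H_i(SG, ℤ) → H_i(S(G₁ × G₂), ℤ)` induced by the projection. -/
def projLinearMap : SHomology i hdet →ₗ[MonoidAlgebra ℤ Fˣ]
    SHomology i (detOn_blockDiagonal_surjective hdet) :=
  homologyLinearMap i hdet (detOn_blockDiagonal_surjective hdet) specialProj fun d => by
    obtain ⟨g, rfl⟩ := hdet d
    exact ⟨g, blockProj g, rfl, detOn_blockProj g, specialProj_conj g⟩

/-- The map `H_i(S(G₁ × G₂), ℤ) → H_i(SG, ℤ)` induced by the inclusion. -/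
def inclLinearMap : SHomology i (detOn_blockDiagonal_surjective hdet) →ₗ[MonoidAlgebra ℤ Fˣ]
    SHomology i hdet :=
  homologyLinearMap i (detOn_blockDiagonal_surjective hdet) hdet
    (specialInclusion (blockDiagonal_le h₁ h₂)) fun d => by
      obtain ⟨g, rfl⟩ := detOn_blockDiagonal_surjective hdet d
      exact ⟨g, Subgroup.inclusion (blockDiagonal_le h₁ h₂) g, rfl, rfl, specialInclusion_conj g⟩

theorem projLinearMap_inclLinearMap (x : SHomology i (detOn_blockDiagonal_surjective hdet)) :
    projLinearMap hdet i (inclLinearMap hdet i x) = x := by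
  have h := homologyMap_comp i (specialProj (h₁ := h₁) (h₂ := h₂))
    (specialInclusion (blockDiagonal_le h₁ h₂))
  rw [show specialProj.comp (specialInclusion (blockDiagonal_le h₁ h₂)) = MonoidHom.id _ from
    MonoidHom.ext specialProj_inclusion, homologyMap_id] at h
  exact (DFunLike.congr_fun h x).symm

theorem isCompl_ker_range :
    IsCompl (LinearMap.ker (projLinearMap hdet i)) (LinearMap.range (inclLinearMap hdet i)) := by
  refine IsCompl.of_eq ?_ ?_
  · rw [Submodule.eq_bot_iff]
    rintro _ ⟨hx, ⟨y, rfl⟩⟩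
    have : y = 0 := (projLinearMap_inclLinearMap hdet i y).symm.trans hx
    rw [this, map_zero]
  · rw [Submodule.eq_top_iff']
    intro x
    rw [← sub_add_cancel x (inclLinearMap hdet i (projLinearMap hdet i x))]
    refine Submodule.add_mem_sup ?_ ⟨_, rfl⟩
    rw [LinearMap.mem_ker, map_sub, projLinearMap_inclLinearMap, sub_self]

include hscalar in
/-- The group `S(G₁ × G₂)` is centralized by the scalars on `V`, so their determinants act trivially
on its homology. -/
theorem isMultiplicative_range_incl [CharZero F] [Nontrivial V] :
    IsMultiplicative F (LinearMap.range (inclLinearMap hdet i)) := by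
  let d := Module.finrank F V
  have hd : d ≠ 0 := (Module.finrank_pos (R := F) (M := V)).ne'
  -- the annihilator is `⟨2 ^ d⟩ - 1`, from the scalar `2`, whose determinant is `2 ^ d`
  let a : ℚˣ := Units.mk0 2 two_ne_zero ^ d
  have ha : (1 : ℚ) < (a : ℚ) := by
    rw [Units.val_pow_eq_pow_val, Units.val_mk0]
    exact one_lt_pow₀ one_lt_two hd
  have h2 : detOn (blockDiagonal G₁ G₂) (scalarElement hscalar (natUnit F 2)) =
      Units.map (Rat.castHom F).toMonoidHom a := by
    rw [detOn_scalarElement]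
    ext
    simp [a, d, natUnit]
  refine ⟨MonoidAlgebra.of ℤ Fˣ (Units.map (Rat.castHom F).toMonoidHom a) - 1,
    Submonoid.subset_closure ⟨a, ?_, ?_, rfl⟩, ?_⟩
  · rintro h
    rw [h] at ha
    simp at ha
  · rintro h
    rw [h] at ha
    norm_num at ha
  · rintro ⟨_, x, rfl⟩
    refine Subtype.ext ?_
    change _ • inclLinearMap hdet i x = 0
    rw [← map_smul, sub_smul, one_smul, ← h2, of_smul_eq]
    have : (MulAut.conjNormal (H := special (blockDiagonal G₁ G₂))
        (scalarElement hscalar (natUnit F 2))).toMonoidHom = MonoidHom.id _ :=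
      MonoidHom.ext (conjNormal_scalarElement hscalar _)
    rw [this, homologyMap_id]
    exact (congrArg _ (sub_self x)).trans (map_zero _)

/-- A rational number different from `±1` has for its square the quotient of two different positive
integers; only squares need consideration, so negative numbers play no special role. -/
theorem exists_natUnit_div [CharZero F] {a : ℚˣ} (h1 : a ≠ 1) (h2 : a ≠ -1) :
    ∃ p q : ℕ+, p ≠ q ∧
      Units.map (Rat.castHom F).toMonoidHom a ^ 2 * (natUnit F p)⁻¹ = (natUnit F q)⁻¹ := by
  have hnum : (a : ℚ).num ≠ 0 := Rat.num_ne_zero.2 a.ne_zero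
  refine ⟨⟨(a : ℚ).num.natAbs ^ 2, pow_pos (Int.natAbs_pos.2 hnum) 2⟩,
    ⟨(a : ℚ).den ^ 2, pow_pos (a : ℚ).den_pos 2⟩, ?_, ?_⟩
  · intro h
    have h3 : (a : ℚ).num.natAbs = (a : ℚ).den :=
      Nat.pow_left_injective two_ne_zero (congrArg PNat.val h)
    have h4 : (a : ℚ).num = (a : ℚ).den ∨ (a : ℚ).num = -((a : ℚ).den : ℤ) := by omega
    have hden : ((a : ℚ).den : ℚ) ≠ 0 := Nat.cast_ne_zero.2 (a : ℚ).den_ne_zero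
    rcases h4 with h4 | h4
    · refine h1 (Units.ext ?_)
      rw [← Rat.num_div_den (a : ℚ), h4, Int.cast_natCast, div_self hden, Units.val_one]
    · refine h2 (Units.ext ?_)
      rw [← Rat.num_div_den (a : ℚ), h4, Int.cast_neg, Int.cast_natCast, neg_div, div_self hden,
        Units.val_neg, Units.val_one]
  · rw [mul_inv_eq_iff_eq_mul, eq_inv_mul_iff_mul_eq]
    ext
    have h3 : ((a : ℚ).den : ℚ) * (a : ℚ) = (a : ℚ).num := by
      rw [mul_comm, Rat.mul_den_eq_num]
    have h4 : (((a : ℚ).den ^ 2 : ℕ) : ℚ) * (a : ℚ) ^ 2 = (((a : ℚ).num.natAbs ^ 2 : ℕ) : ℚ) := by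
      rw [Nat.cast_pow, ← mul_pow, h3, Nat.cast_pow, Nat.cast_natAbs, Int.cast_abs, sq_abs]
    have h5 := congrArg (Rat.cast : ℚ → F) h4
    rw [Rat.cast_mul, Rat.cast_natCast, Rat.cast_natCast, Rat.cast_pow] at h5
    exact h5

include hscalar in
/-- The scalar `m⁻¹` on `V` has determinant `m ^ (-dim V)`, which thus acts on `H_i(SG, ℤ)` through
`scalarConj`; two such actions are compared here. -/
theorem of_sub_of_smul_eq [CharZero F] (p q : ℕ+) (x : SHomology i hdet) :
    (MonoidAlgebra.of ℤ Fˣ ((natUnit F q)⁻¹ ^ Module.finrank F V) -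
      MonoidAlgebra.of ℤ Fˣ ((natUnit F p)⁻¹ ^ Module.finrank F V)) • x =
      (homologyMap i (scalarConj hscalar q).toMonoidHom x -
        homologyMap i (scalarConj hscalar p).toMonoidHom x : Homology i _) := by
  have hU : ∀ m : ℕ+, MonoidAlgebra.of ℤ Fˣ ((natUnit F m)⁻¹ ^ Module.finrank F V) • x =
      homologyMap i (scalarConj hscalar m).toMonoidHom x := by
    intro m
    refine Eq.trans ?_ (of_smul_eq i hdet (Subgroup.inclusion (blockDiagonal_le h₁ h₂)
      (scalarElement hscalar (natUnit F m)⁻¹)) x)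
    refine congrArg (fun t => MonoidAlgebra.of ℤ Fˣ t • x) ?_
    exact (detOn_scalarElement (G₁ := G₁) hscalar _).symm
  rw [sub_smul, hU, hU]
  rfl

include hscalar in
theorem smul_bijective_ker_proj [CharZero F] {p q : ℕ+} (hpq : p ≠ q) :
    Function.Bijective fun x : LinearMap.ker (projLinearMap hdet i) =>
      (MonoidAlgebra.of ℤ Fˣ ((natUnit F q)⁻¹ ^ Module.finrank F V) -
        MonoidAlgebra.of ℤ Fˣ ((natUnit F p)⁻¹ ^ Module.finrank F V)) • x := by
  obtain ⟨hinj, hsurj⟩ := homologyMap_sub_bijective (specialProj_inclusion (h₁ := h₁) (h₂ := h₂))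
    (specialProj_scalarConj hscalar) (scalarConj_ker hscalar) (hasPowWeight_ker_specialProj _)
    hpq.symm i
  have hU := of_sub_of_smul_eq hscalar hdet i p q
  refine bijective_smul_ker _ _ (fun x hx hx0 => ?_) fun x hx => ?_
  · exact hinj x hx ((hU x).symm.trans hx0)
  · obtain ⟨y, hy, hyx⟩ := hsurj x hx
    exact ⟨y, hy, (hU y).trans hyx⟩

include hscalar in
/-- The kernel of `H_i(SG, ℤ) → H_i(S(G₁ × G₂), ℤ)` is additive. -/
theorem isAdditive_ker_proj [CharZero F] :
    IsAdditive F (LinearMap.ker (projLinearMap hdet i)) := by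
  refine isAdditive_of_generators fun a h1 h2 => ?_
  obtain ⟨p, q, hpq, ha⟩ := exists_natUnit_div (F := F) h1 h2
  refine bijective_smul_of_dvd ?_ (smul_bijective_ker_proj hscalar hdet i hpq)
  -- `⟨a⟩ - 1` divides `⟨a ^ (2 * dim V)⟩ - 1`, a unit multiple of the operator in question
  refine (sub_one_dvd_pow_sub_one _ (2 * Module.finrank F V)).trans
    ⟨MonoidAlgebra.of ℤ Fˣ ((natUnit F p)⁻¹ ^ Module.finrank F V), ?_⟩
  rw [sub_mul, one_mul, ← map_pow, ← map_mul, pow_mul, ← mul_pow, ha]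

end Special

end BlockGroups

end

end SpecialHomology

open SpecialHomology

theorem mainTheorem3 {F : Type u} [Field F] [CharZero F]
    {V W : Type u} [AddCommGroup V] [Module F V] [FiniteDimensional F V] [Nontrivial V]
    [AddCommGroup W] [Module F W] [FiniteDimensional F W]
    (G₁ : Subgroup (LinearMap.GeneralLinearGroup F W))
    (G₂ : Subgroup (LinearMap.GeneralLinearGroup F V))
    (hscalar : ∀ a : Fˣ, Units.map (algebraMap F (Module.End F V)).toMonoidHom a ∈ G₂)
    (M : Submodule F (V →ₗ[F] W))
    (h₁ : ∀ g ∈ G₁, ∀ f ∈ M, g.val ∘ₗ f ∈ M)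
    (h₂ : ∀ g ∈ G₂, ∀ f ∈ M, f ∘ₗ g.val ∈ M)
    (hdet : Function.Surjective (detOn (blockTriangular G₁ G₂ M h₁ h₂)))
    (i : ℕ) (hi : 1 ≤ i) :
    IsAM F (SHomology i hdet) ∧
    IsAdditive F (additivePart F (SHomology i hdet)) ∧
    IsMultiplicative F (multiplicativePart F (SHomology i hdet)) ∧
    IsCompl (additivePart F (SHomology i hdet)) (multiplicativePart F (SHomology i hdet)) ∧
    ∃ e : SHomology i (detOn_blockDiagonal_surjective hdet) ≃ₗ[MonoidAlgebra ℤ Fˣ]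
        multiplicativePart F (SHomology i hdet),
      ∀ x, (e x : SHomology i hdet) =
        homologyMap i (specialInclusion (blockDiagonal_le h₁ h₂)) x := by
  have hC := isCompl_ker_range hdet i
  have hA := isAdditive_ker_proj hscalar hdet i
  have hM := isMultiplicative_range_incl hscalar hdet i
  have hinj : Function.Injective (inclLinearMap hdet i) :=
    Function.LeftInverse.injective (projLinearMap_inclLinearMap hdet i)
  refine ⟨isAM_of_isCompl hC hA hM, ?_⟩
  rw [additivePart_eq hC hA hM, multiplicativePart_eq hC hA hM]
  exact ⟨hA, hM, hC, LinearEquiv.ofInjective _ hinj, fun x => rfl⟩
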